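/- Let $V$ be a finite set and let $\Delta$ be a simplicial complex on $V$, i.e. a non-void family of subsets of $V$ that is closed under taking subsets and contains $\{v\}$ for every $v\in V$. For $F\in\Delta$ put $\dim F=\sharp(F)-1$, and let $\dim\Delta$ be the maximum of $\dim F$ over all faces $F\in\Delta$ (so $\dim\{\emptyset\}=-1$). For $F\in\Delta$ and $U\subseteq V$ put $$\operatorname{link}_\Delta(F)=\{G\in\Delta : G\cup F\in\Delta,\ G\cap F=\emptyset\},\qquad \Delta_U=\{G\in\Delta : G\subseteq U\}.$$ Let $K$ be a field. For a simplicial complex $\Gamma$ let $S_\Gamma$ be the polynomial ring over $K$ in the variables $X_v$, $v$ a vertex of $\Gamma$; let $I_\Gamma\subseteq S_\Gamma$ be the ideal generated by the squarefree monomials $\prod_{v\in F}X_v$ for the sets $F$ of vertices with $F\notin\Gamma$; and let $K[\Gamma]=S_\Gamma/I_\Gamma$. The complex $\Gamma$ is called a complete intersection complex if $I_\Gamma$ is generated by a (possibly empty) regular sequence. A finitely generated $K$-algebra $R$ is called a complete intersection ring if all its local rings are complete intersections, that is, if $R\cong K[x_1,\dots,x_n]/J$ for some $n$ and some ideal $J$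 such that for every prime ideal $P\supseteq J$ the ideal $J_P$ of $K[x_1,\dots,x_n]_P$ is generated by a regular sequence. A Noetherian ring $R$ satisfies Serre's condition $(S_2)$ if $\operatorname{depth} R_P\ge\min\{\dim R_P,2\}$ for every prime ideal $P$ of $R$. Assume that $\dim\Delta\ge 2$ and that $K[\Delta]$ satisfies $(S_2)$. Then the following conditions are equivalent: 1. $K[\Delta]$ is a complete intersection ring; 2. for every face $F\in\Delta$ with $\dim\operatorname{link}_\Delta(F)=1$, the complex $\operatorname{link}_\Delta(F)$ is a complete intersection complex; 3. there exists $W\subseteq V$ with $\dim\Delta_{V\setminus W}\le\dim\Delta-3$ such that $\operatorname{link}_\Delta(\{x\})$ is a complete intersection complex for every $x\in W$. -/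

import Mathlib

/-! ### Simplicial complexes

Mathlib's complexes do not list the empty set among their faces; below it is always
counted as a face, as is customary for Stanley-Reisner rings. -/

namespace PreAbstractSimplicialComplex

variable {V : Type*}

/-- `F` is a face of `Δ`, the empty face included. -/
def IsFace (Δ : PreAbstractSimplicialComplex V) (F : Finset V) : Prop :=
  F = ∅ ∨ F ∈ Δ.faces

/-- The vertex set of `Δ`. -/
def vertices (Δ : PreAbstractSimplicialComplex V) : Set V :=
  {v | {v} ∈ Δ.faces}

/-- The dimension of `Δ` (for finite `V`): the maximum of `#F - 1` over all faces `F`.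
The complex `{∅}` has dimension `-1`. -/
noncomputable def dim (Δ : PreAbstractSimplicialComplex V) : ℤ :=
  ((sSup (Finset.card '' {F | Δ.IsFace F}) : ℕ) : ℤ) - 1

/-- The link of `F` in `Δ`: the faces `G` of `Δ` with `G ∪ F ∈ Δ` and `F ∩ G = ∅`. -/
def link [DecidableEq V] (Δ : PreAbstractSimplicialComplex V) (F : Finset V) :
    PreAbstractSimplicialComplex V where
  faces := {G | G ∈ Δ.faces ∧ Δ.IsFace (G ∪ F) ∧ F ∩ G = ∅}
  isRelLowerSet_faces := by
    rintro G ⟨hG, hGF, hd⟩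
    refine ⟨(Δ.isRelLowerSet_faces hG).1, fun H hH hne => ?_⟩
    refine ⟨(Δ.isRelLowerSet_faces hG).2 hH hne, Or.inr ?_, ?_⟩
    · have hGF' : G ∪ F ∈ Δ.faces := by
        rcases hGF with h | h
        · have hG0 := (Finset.union_eq_empty.mp h).1
          exact absurd hG0 (Δ.isRelLowerSet_faces hG).1.ne_empty
        · exact h
      exact (Δ.isRelLowerSet_faces hGF').2 (Finset.union_subset_union_left hH)
        (hne.mono Finset.subset_union_left)
    · exact Finset.subset_empty.mp (hd ▸ Finset.inter_subset_inter_left hH)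

/-- The restriction `Δ_W = {G ∈ Δ : G ⊆ W}`. -/
def restrict (Δ : PreAbstractSimplicialComplex V) (W : Set V) :
    PreAbstractSimplicialComplex V where
  faces := {G | G ∈ Δ.faces ∧ (G : Set V) ⊆ W}
  isRelLowerSet_faces := by
    rintro G ⟨hG, hGW⟩
    refine ⟨(Δ.isRelLowerSet_faces hG).1, fun H hH hne => ?_⟩
    exact ⟨(Δ.isRelLowerSet_faces hG).2 hH hne, fun x hx => hGW (hH hx)⟩

/-- The Stanley-Reisner ideal of `Δ`, in the polynomial ring whose variables are the vertices
of `Δ`: it is generated by the squarefree monomials supported on the nonfaces. -/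
noncomputable def stanleyReisnerIdeal (Δ : PreAbstractSimplicialComplex V)
    (K : Type*) [Field K] : Ideal (MvPolynomial Δ.vertices K) :=
  Ideal.span {m | ∃ F : Finset Δ.vertices,
    ¬ Δ.IsFace (F.map (Function.Embedding.subtype _)) ∧ m = ∏ v ∈ F, MvPolynomial.X v}

/-- The Stanley-Reisner ring `K[Δ]`. -/
abbrev StanleyReisnerRing (Δ : PreAbstractSimplicialComplex V) (K : Type*) [Field K] : Type _ :=
  MvPolynomial Δ.vertices K ⧸ Δ.stanleyReisnerIdeal K

end PreAbstractSimplicialComplex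

/-! ### Complete intersections -/

/-- The ideal `I` is a complete intersection ideal: it is generated by a (possibly empty)
regular sequence. -/
def Ideal.IsCompleteIntersection {A : Type*} [CommRing A] (I : Ideal A) : Prop :=
  ∃ rs : List A, RingTheory.Sequence.IsRegular A rs ∧ Ideal.ofList rs = I

/-- The complex `Δ` is a complete intersection complex (over `K`): its Stanley-Reisner ideal is
generated by a regular sequence. -/
def PreAbstractSimplicialComplex.IsCompleteIntersection {V : Type*}
    (Δ : PreAbstractSimplicialComplex V) (K : Type*) [Field K] : Prop :=
  (Δ.stanleyReisnerIdeal K).IsCompleteIntersection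

/-- The finitely generated `K`-algebra `R` is a complete intersection ring, that is, all its local
rings are complete intersections: `R` is a quotient `K[x₁, …, xₙ]/J` such that at every prime
`P ⊇ J` the ideal `J_P` of the regular local ring `K[x₁, …, xₙ]_P` is generated by a regular
sequence. -/
def IsCompleteIntersectionRing (K R : Type*) [Field K] [CommRing R] [Algebra K R] : Prop :=
  ∃ (n : ℕ) (J : Ideal (MvPolynomial (Fin n) K)),
    Nonempty (R ≃ₐ[K] (MvPolynomial (Fin n) K ⧸ J)) ∧
    ∀ (P : Ideal (MvPolynomial (Fin n) K)) [P.IsPrime], J ≤ P →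
      (J.map (algebraMap _ (Localization.AtPrime P))).IsCompleteIntersection

/-! ### Serre's condition -/

/-- The depth of a (Noetherian) local ring: the supremum of the lengths of regular sequences
contained in the maximal ideal. -/
noncomputable def localRingDepth (R : Type*) [CommRing R] [IsLocalRing R] : ℕ∞ :=
  ⨆ rs ∈ {rs : List R | (∀ r ∈ rs, r ∈ IsLocalRing.maximalIdeal R) ∧
    RingTheory.Sequence.IsRegular R rs}, (rs.length : ℕ∞)

/-- Serre's condition `(S₂)`: `R` is Noetherian and `depth R_P ≥ min {dim R_P, 2}` for every
prime `P` of `R`. -/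
def SatisfiesSerreS2 (R : Type*) [CommRing R] : Prop :=
  IsNoetherianRing R ∧ ∀ (P : Ideal R) [P.IsPrime],
    min (ringKrullDim (Localization.AtPrime P)) 2 ≤
      (localRingDepth (Localization.AtPrime P) : WithBot ℕ∞)

/-!
All three conditions are compared with the combinatorial property that distinct minimal nonfaces of
`Δ` are disjoint (`DisjointMinNonfaces`).

*Algebra.* If the minimal nonfaces are disjoint, the corresponding squarefree monomials form a
regular sequence. Conversely, let `K[x₁, …, xₙ]/J` be a presentation of `K[Δ]` in which `J` is
generated by a regular sequence of length `r`, locally at the vertex point, that is, where all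
variables of `K[Δ]` vanish. The prime of a face `F` has height at least `r`, and a chain of `#F`
further primes leads from it to the prime of the vertex point, so `r + #F ≤ n`. To get from `J` to
the Stanley-Reisner ideal, one presents `K[Δ]` on both sets of variables: in suitable coordinates
the kernel is a monomial ideal, minimally generated by `n` variables and the monomials of the `g`
minimal nonfaces; locally at the vertex point it is also generated by `#V + r` elements. The
coefficients of the minimal generators are functionals on the kernel which show that
`n + g ≤ #V + r`. Hence `g + #F ≤ #V` for every face `F`: no set with fewer than `g` elements meets
all minimal nonfaces, and so no two of them share a vertex. Therefore being a complete intersection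
ring, being a complete intersection complex and having disjoint minimal nonfaces are the same
(`isCompleteIntersectionRing_iff`, `isCompleteIntersection_iff`).

*Serre's condition.* If the link of `F` has dimension at least one and is disconnected, the maximal
ideal of the localization of `K[Δ]` at the prime of `F` is a sum of two nonzero ideals with product
zero, which is impossible in depth two. So `(S₂)` makes all these links connected, and then `Δ` is
pure (`card_eq_of_maximal`).

*Combinatorics.* Disjointness of minimal nonfaces passes to links, which yields (1) ⇒ (3), with `W`
the set of all vertices, and (3) ⇒ (2): by purity a face with one-dimensional link has too many
vertices to avoid `W`. The main point is (2) ⇒ (1), by descending induction over the links: a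
connected complex in which every edge lies in a triangle has disjoint minimal nonfaces as soon as
all its vertex links do (`disjointMinNonfaces_of_vertex_links`).
-/

/-! ### Minimal nonfaces and links of families of finite sets -/

section Combinatorics

open Finset

variable {V : Type*}

/-- `N` is a minimal nonface of the family `𝒦` of faces. Only the points `v` with `{v} ∈ 𝒦` count
as vertices, so a singleton outside `𝒦` is not a minimal nonface. -/
def IsMinNonface (𝒦 : Set (Finset V)) (N : Finset V) : Prop :=
  Minimal (· ∉ 𝒦) N ∧ ∀ v ∈ N, {v} ∈ 𝒦

/-- Distinct minimal nonfaces are disjoint. This is the combinatorial form of being a complete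
intersection complex. -/
def DisjointMinNonfaces (𝒦 : Set (Finset V)) : Prop :=
  {N | IsMinNonface 𝒦 N}.PairwiseDisjoint id

theorem exists_isMinNonface_subset {𝒦 : Set (Finset V)} {N : Finset V} (hN : N ∉ 𝒦)
    (hv : ∀ v ∈ N, {v} ∈ 𝒦) : ∃ M ⊆ N, IsMinNonface 𝒦 M := by
  obtain ⟨M, hMN, hM⟩ := exists_minimal_le_of_wellFoundedLT (· ∉ 𝒦) N hN
  exact ⟨M, hMN, hM, fun v hv' => hv v (hMN hv')⟩

theorem IsMinNonface.mem_of_ssubset {𝒦 : Set (Finset V)} {N M : Finset V}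
    (hN : IsMinNonface 𝒦 N) (h : M ⊂ N) : M ∈ 𝒦 := by
  by_contra hM
  exact hN.1.not_lt hM h

theorem isMinNonface_of_ssubset {𝒦 : Set (Finset V)} {N : Finset V} (hN : N ∉ 𝒦)
    (hv : ∀ v ∈ N, {v} ∈ 𝒦) (h : ∀ M ⊂ N, M ∈ 𝒦) : IsMinNonface 𝒦 N :=
  ⟨minimal_iff_forall_lt.2 ⟨hN, fun M hM hM' => hM' (h M hM)⟩, hv⟩

theorem DisjointMinNonfaces.eq {𝒦 : Set (Finset V)} (h : DisjointMinNonfaces 𝒦) {A B : Finset V}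
    (hA : IsMinNonface 𝒦 A) (hB : IsMinNonface 𝒦 B) {c : V} (hcA : c ∈ A) (hcB : c ∈ B) :
    A = B := by
  by_contra hne
  exact Finset.disjoint_left.1 (h hA hB hne) hcA hcB

theorem IsMinNonface.two_le_card {𝒦 : Set (Finset V)} (h0 : ∅ ∈ 𝒦) {N : Finset V}
    (hN : IsMinNonface 𝒦 N) :
    2 ≤ #N := by
  by_contra h
  rcases N.eq_empty_or_nonempty with rfl | ⟨v, hv⟩
  · exact hN.1.prop h0
  · have : N = {v} := by
      have := Finset.card_pos.2 ⟨v, hv⟩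
      obtain ⟨w, rfl⟩ := Finset.card_eq_one.1 (show #N = 1 by omega)
      simp_all
    exact hN.1.prop (this ▸ hN.2 v hv)

variable [DecidableEq V]

/-- The link of `F` in a family of faces; unlike a `PreAbstractSimplicialComplex` it contains the
empty face. -/
def linkFamily (𝒦 : Set (Finset V)) (F : Finset V) : Set (Finset V) :=
  {G | Disjoint G F ∧ G ∪ F ∈ 𝒦}

/-- The graph of vertices and edges of `𝒦` is connected: a nonempty set of vertices that is closed
under adjacency contains all vertices. The empty graph counts as connected. -/
def ConnectedFamily (𝒦 : Set (Finset V)) : Prop :=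
  ∀ S : Set V, (∃ v ∈ S, {v} ∈ 𝒦) → (∀ v ∈ S, ∀ w, {v, w} ∈ 𝒦 → w ∈ S) →
    ∀ w, {w} ∈ 𝒦 → w ∈ S

theorem isLowerSet_linkFamily {𝒦 : Set (Finset V)} (h𝒦 : IsLowerSet 𝒦) (F : Finset V) :
    IsLowerSet (linkFamily 𝒦 F) := fun _ _ hAB hA =>
  ⟨hA.1.mono_left hAB, h𝒦 (Finset.union_subset_union_left hAB) hA.2⟩

theorem linkFamily_linkFamily (𝒦 : Set (Finset V)) {F G : Finset V} (h : Disjoint F G) :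
    linkFamily (linkFamily 𝒦 F) G = linkFamily 𝒦 (F ∪ G) := by
  ext A
  simp only [linkFamily, Set.mem_ofPred_eq, disjoint_union_left, disjoint_union_right,
    show A ∪ G ∪ F = A ∪ (F ∪ G) by grind, h.symm]
  tauto

@[simp]
theorem linkFamily_empty (𝒦 : Set (Finset V)) : linkFamily 𝒦 ∅ = 𝒦 := by
  ext A
  simp [linkFamily]

/-- A minimal nonface `N` of the link of `F` is the trace `M \ F` of a minimal nonface `M`, so
disjointness is inherited by links. -/
theorem DisjointMinNonfaces.linkFamily {𝒦 : Set (Finset V)} (h𝒦 : IsLowerSet 𝒦)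
    (h : DisjointMinNonfaces 𝒦) {F : Finset V} (hF : F ∈ 𝒦) :
    DisjointMinNonfaces (linkFamily 𝒦 F) := by
  have key : ∀ N, IsMinNonface (_root_.linkFamily 𝒦 F) N → ∃ M, IsMinNonface 𝒦 M ∧ M \ F = N := by
    intro N hN
    have hNF : Disjoint N F := by
      rw [Finset.disjoint_left]
      intro v hv
      exact Finset.disjoint_singleton_left.1 (hN.2 v hv).1
    obtain ⟨M, hMN, hM⟩ := exists_isMinNonface_subset (𝒦 := 𝒦) (N := N ∪ F)
      (fun h' => hN.1.prop ⟨hNF, h'⟩) (fun v hv => by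
        rcases Finset.mem_union.1 hv with hv | hv
        · exact h𝒦 (Finset.subset_union_left) (hN.2 v hv).2
        · exact h𝒦 (Finset.singleton_subset_iff.2 hv) hF)
    refine ⟨M, hM, ?_⟩
    have hsub : M \ F ⊆ N := by grind
    refine (hN.1.eq_of_le (y := M \ F) (fun h' => hM.1.prop (h𝒦 ?_ h'.2)) hsub)
    intro x hx
    by_cases hxF : x ∈ F <;> simp [hx, hxF]
  intro A hA B hB hne
  obtain ⟨A', hA', rfl⟩ := key A hA
  obtain ⟨B', hB', rfl⟩ := key B hB
  have : A' ≠ B' := by rintro rfl; exact hne rfl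
  exact (h hA' hB' this).mono Finset.sdiff_subset Finset.sdiff_subset

/-! ### Complexes whose vertex links have disjoint minimal nonfaces -/

section VertexLinks

variable {𝒦 : Set (Finset V)}

theorem singleton_mem_linkFamily {x b : V} (hxb : x ≠ b) (h : {x, b} ∈ 𝒦) :
    {b} ∈ linkFamily 𝒦 {x} := by
  refine ⟨by simpa using hxb.symm, ?_⟩
  rwa [show ({b} ∪ {x} : Finset V) = {x, b} by grind]

theorem IsMinNonface.erase (h𝒦 : IsLowerSet 𝒦) {N : Finset V} (hN : IsMinNonface 𝒦 N)
    (hcard : 3 ≤ #N) {x : V} (hx : x ∈ N) : IsMinNonface (linkFamily 𝒦 {x}) (N.erase x) := by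
  refine isMinNonface_of_ssubset (fun h => hN.1.prop ?_) (fun v hv => ?_) (fun M hM => ?_)
  · exact h𝒦 (by grind) h.2
  · refine singleton_mem_linkFamily (by grind) (hN.mem_of_ssubset ?_)
    refine Finset.ssubset_iff_subset_ne.2 ⟨by grind, ?_⟩
    rintro rfl
    have := Finset.card_le_two (a := x) (b := v)
    omega
  · obtain ⟨hM1, hM2⟩ := Finset.ssubset_iff_subset_ne.1 hM
    refine ⟨Finset.disjoint_singleton_right.2 (by grind), hN.mem_of_ssubset ?_⟩
    refine Finset.ssubset_iff_subset_ne.2 ⟨by grind, ?_⟩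
    rintro rfl
    apply hM2
    grind

theorem isMinNonface_pair_linkFamily (h𝒦 : IsLowerSet 𝒦) {x a b : V} (hxa : x ≠ a) (hxb : x ≠ b)
    (ha : {x, a} ∈ 𝒦) (hb : {x, b} ∈ 𝒦) (hab : {a, b} ∉ 𝒦) :
    IsMinNonface (linkFamily 𝒦 {x}) {a, b} := by
  have h0 : ({b} : Finset V) ∈ linkFamily 𝒦 {x} := singleton_mem_linkFamily hxb hb
  have h1 : ({a} : Finset V) ∈ linkFamily 𝒦 {x} := singleton_mem_linkFamily hxa ha
  refine isMinNonface_of_ssubset (fun h => hab ?_) (fun v hv => ?_) (fun M hM => ?_)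
  · exact h𝒦 (by grind) h.2
  · rcases Finset.mem_insert.1 hv with rfl | hv
    · exact h1
    · rw [Finset.mem_singleton.1 hv]; exact h0
  · by_cases haM : a ∈ M
    · have : b ∉ M := fun hbM => hM.2 (by grind)
      exact isLowerSet_linkFamily h𝒦 _ (show M ⊆ {a} by grind) h1
    · exact isLowerSet_linkFamily h𝒦 _ (show M ⊆ {b} by grind) h0

theorem exists_isMinNonface_linkFamily (h𝒦 : IsLowerSet 𝒦) {x : V} {N : Finset V}
    (hx : x ∉ N) (hadj : ∀ b ∈ N, {x, b} ∈ 𝒦) (hN : insert x N ∉ 𝒦) :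
    ∃ M ⊆ N, IsMinNonface (linkFamily 𝒦 {x}) M :=
  exists_isMinNonface_subset (fun h => hN (h𝒦 (by grind) h.2)) fun v hv =>
    singleton_mem_linkFamily (by grind) (hadj v hv)

/-- Among the neighbours of a vertex the missing edges form a matching. -/
theorem pair_mem_of_pair_notMem (h𝒦 : IsLowerSet 𝒦)
    (hlink : ∀ v, {v} ∈ 𝒦 → DisjointMinNonfaces (linkFamily 𝒦 {v})) {x a b c : V}
    (hxa : x ≠ a) (hxb : x ≠ b) (hxc : x ≠ c) (ha : {x, a} ∈ 𝒦) (hb : {x, b} ∈ 𝒦)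
    (hc : {x, c} ∈ 𝒦) (hbc : b ≠ c) (hab : {a, b} ∉ 𝒦) : {a, c} ∈ 𝒦 := by
  by_contra hac
  have hx : {x} ∈ 𝒦 := h𝒦 (by grind) ha
  have := (hlink x hx).eq (isMinNonface_pair_linkFamily h𝒦 hxa hxb ha hb hab)
    (isMinNonface_pair_linkFamily h𝒦 hxa hxc ha hc hac) (c := a) (by simp) (by simp)
  have hb' : b ∈ ({a, c} : Finset V) := this ▸ (by simp)
  have hc' : c ∈ ({a, b} : Finset V) := this ▸ (by simp)
  grind

/-- In a connected complex whose vertex links are complete intersections, a minimal nonface with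
at least three vertices is joined to every other vertex. -/
theorem IsMinNonface.pair_mem (h𝒦 : IsLowerSet 𝒦) (hconn : ConnectedFamily 𝒦)
    (hlink : ∀ v, {v} ∈ 𝒦 → DisjointMinNonfaces (linkFamily 𝒦 {v})) {B : Finset V}
    (hB : IsMinNonface 𝒦 B) (hcard : 3 ≤ #B) {w : V} (hw : {w} ∈ 𝒦) {b : V} (hb : b ∈ B) :
    {w, b} ∈ 𝒦 := by
  have hpair : ∀ b ∈ B, ∀ c ∈ B, {b, c} ∈ 𝒦 := by
    intro b hb c hc
    refine hB.mem_of_ssubset (Finset.ssubset_iff_subset_ne.2 ⟨by grind, ?_⟩)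
    rintro rfl
    have := Finset.card_le_two (a := b) (b := c)
    omega
  -- A vertex outside `B` joined to one vertex of `B` is joined to all of them.
  have hall : ∀ u ∉ B, ∀ b ∈ B, {u, b} ∈ 𝒦 → ∀ c ∈ B, {u, c} ∈ 𝒦 := by
    intro u hu b hb hub c hc
    by_contra huc
    have hbc : b ≠ c := by rintro rfl; exact huc hub
    have hub' : b ≠ u := by rintro rfl; exact hu hb
    have h1 := isMinNonface_pair_linkFamily h𝒦 hub' hbc (Finset.pair_comm u b ▸ hub)
      (hpair b hb c hc) huc
    have h2 := hB.erase h𝒦 hcard hb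
    have := (hlink b (hB.2 b hb)).eq h1 h2 (c := c) (by simp) (by grind)
    have : u ∈ B.erase b := this ▸ (by simp)
    grind
  obtain ⟨b₁, hb₁, b₂, hb₂, hb₁₂⟩ := Finset.one_lt_card.1 (show 1 < #B by omega)
  have := hconn {w : V | ∀ c ∈ B, {w, c} ∈ 𝒦} ⟨b, fun c hc => hpair b hb c hc, hB.2 b hb⟩
    (fun v hv w hvw => by
    by_cases hwB : w ∈ B
    · exact hpair w hwB
    have hwv : {w, v} ∈ 𝒦 := Finset.pair_comm v w ▸ hvw
    by_cases hvB : v ∈ B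
    · exact hall w hwB v hvB hwv
    by_cases hwv' : v = w
    · exact hwv' ▸ hv
    by_contra hcon
    have hno : ∀ c ∈ B, {w, c} ∉ 𝒦 := fun c hc hwc => hcon (hall w hwB c hc hwc)
    -- Otherwise `{w, b₁}` and `{w, b₂}` are two missing edges at `w` in the link of `v`.
    exact hno b₂ hb₂ (pair_mem_of_pair_notMem h𝒦 hlink (x := v) hwv' (by grind) (by grind) hvw
      (hv b₁ hb₁) (hv b₂ hb₂) hb₁₂ (hno b₁ hb₁))) w hw
  exact this b hb

/-- The vertex-link conditions force any two vertices of a connected complex of dimension at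
least two to be equal, adjacent, or to have a common neighbour. -/
theorem exists_common_neighbour (h𝒦 : IsLowerSet 𝒦) (hconn : ConnectedFamily 𝒦)
    (htri : ∀ v w, v ≠ w → {v, w} ∈ 𝒦 → ∃ z, z ≠ v ∧ z ≠ w ∧ {v, w, z} ∈ 𝒦)
    (hlink : ∀ v, {v} ∈ 𝒦 → DisjointMinNonfaces (linkFamily 𝒦 {v})) {v w : V}
    (hv : {v} ∈ 𝒦) (hw : {w} ∈ 𝒦) (hvw : {v, w} ∉ 𝒦) :
    ∃ x, {v, x} ∈ 𝒦 ∧ {x, w} ∈ 𝒦 ∧ x ≠ v ∧ x ≠ w := by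
  have hmem := hconn {w | ∃ x, {v, x} ∈ 𝒦 ∧ {x, w} ∈ 𝒦} ⟨v, ⟨v, by simpa, by simpa⟩, hv⟩ (by
    rintro w ⟨x, hvx, hxw⟩ y hwy
    by_contra hcon
    have hno : ∀ x, {v, x} ∈ 𝒦 → {x, y} ∉ 𝒦 := fun x h1 h2 => hcon ⟨x, h1, h2⟩
    have hvw : {v, w} ∉ 𝒦 := fun h => hno w h hwy
    have hxy : {x, y} ∉ 𝒦 := hno x hvx
    have hxv : x ≠ v := by rintro rfl; exact hvw hxw
    have hxw' : x ≠ w := by rintro rfl; exact hxy hwy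
    have hwy' : w ≠ y := by rintro rfl; exact hxy hxw
    -- On a path `v, x, w, y` the third vertex of a triangle on `v, x` is joined to `w` and to `y`.
    obtain ⟨z, hzv, hzx, hz⟩ := htri v x hxv.symm hvx
    have hvz : {v, z} ∈ 𝒦 := h𝒦 (by grind) hz
    have hxz : {x, z} ∈ 𝒦 := h𝒦 (by grind) hz
    have hzw : z ≠ w := by rintro rfl; exact hvw hvz
    have hwz : {w, z} ∈ 𝒦 := pair_mem_of_pair_notMem h𝒦 hlink (x := x) (b := v) hxw' hxv hzx.symm
      hxw (Finset.pair_comm v x ▸ hvx) hxz hzv.symm (Finset.pair_comm v w ▸ hvw)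
    have hyz : {y, z} ∈ 𝒦 := pair_mem_of_pair_notMem h𝒦 hlink (x := w) (b := x) hwy' hxw'.symm
      hzw.symm hwy (Finset.pair_comm x w ▸ hxw) hwz hzx.symm (Finset.pair_comm x y ▸ hxy)
    exact hno z hvz (Finset.pair_comm y z ▸ hyz)) w hw
  obtain ⟨x, h1, h2⟩ := hmem
  refine ⟨x, h1, h2, ?_, ?_⟩
  · rintro rfl; exact hvw h2
  · rintro rfl; exact hvw h1

/-- Two distinct missing edges cannot share a vertex. -/
theorem eq_of_pair_notMem (h𝒦 : IsLowerSet 𝒦) (hconn : ConnectedFamily 𝒦)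
    (htri : ∀ v w, v ≠ w → {v, w} ∈ 𝒦 → ∃ z, z ≠ v ∧ z ≠ w ∧ {v, w, z} ∈ 𝒦)
    (hlink : ∀ v, {v} ∈ 𝒦 → DisjointMinNonfaces (linkFamily 𝒦 {v})) {v w u : V}
    (hv : {v} ∈ 𝒦) (hw : {w} ∈ 𝒦) (hu : {u} ∈ 𝒦) (hvw : {v, w} ∉ 𝒦) (hvu : {v, u} ∉ 𝒦) :
    w = u := by
  by_contra hne
  obtain ⟨x, hvx, hxw, hxv', hxw'⟩ := exists_common_neighbour h𝒦 hconn htri hlink hv hw hvw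
  obtain ⟨y, hvy, hyu, hyv', hyu'⟩ := exists_common_neighbour h𝒦 hconn htri hlink hv hu hvu
  -- No vertex is joined to all of `v`, `w`, `u`.
  have hno : ∀ z, z ≠ v → {v, z} ∈ 𝒦 → {z, w} ∈ 𝒦 → {z, u} ∉ 𝒦 := by
    intro z hzv h1 h2 h3
    have hzw : z ≠ w := by rintro rfl; exact hvw h1
    have hzu : z ≠ u := by rintro rfl; exact hvu h1
    exact hvu (pair_mem_of_pair_notMem h𝒦 hlink (x := z) hzv hzw hzu (Finset.pair_comm v z ▸ h1)
      h2 h3 hne hvw)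
  obtain ⟨z, hzv, hzx, hz⟩ := htri v x hxv'.symm hvx
  have hvz : {v, z} ∈ 𝒦 := h𝒦 (by grind) hz
  have hxz : {x, z} ∈ 𝒦 := h𝒦 (by grind) hz
  have hwz : {w, z} ∈ 𝒦 := pair_mem_of_pair_notMem h𝒦 hlink (x := x) (b := v) hxw' hxv' hzx.symm
      hxw (Finset.pair_comm v x ▸ hvx) hxz hzv.symm (Finset.pair_comm v w ▸ hvw)
  have hzw : z ≠ w := by rintro rfl; exact hvw hvz
  have hyw : {y, w} ∉ 𝒦 := fun h => hno y hyv' hvy h hyu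
  -- A common neighbour of `v` and `w` is not joined to `y`.
  have hyt : ∀ t, t ≠ v → t ≠ w → {v, t} ∈ 𝒦 → {t, w} ∈ 𝒦 → {y, t} ∉ 𝒦 := by
    intro t htv htw h1 h2 h3
    have hty : t ≠ y := by rintro rfl; exact hyw h2
    exact hyw (Finset.pair_comm w y ▸ pair_mem_of_pair_notMem h𝒦 hlink (x := t) (b := v)
      htw htv hty h2
      (Finset.pair_comm v t ▸ h1) (Finset.pair_comm y t ▸ h3) hyv'.symm
      (Finset.pair_comm v w ▸ hvw))
  -- So `{y, x}` and `{y, z}` are two missing edges at `y` in the link of `v`.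
  have hyx := hyt x hxv' hxw' hvx hxw
  have hyz := hyt z hzv hzw hvz (Finset.pair_comm w z ▸ hwz)
  exact hyz (pair_mem_of_pair_notMem h𝒦 hlink (x := v) hyv'.symm hxv'.symm hzv.symm hvy hvx hvz
    hzx.symm hyx)

/-- Two minimal nonfaces with at least three vertices that meet are equal. -/
theorem eq_of_isMinNonface_of_three_le_card (h𝒦 : IsLowerSet 𝒦) (hconn : ConnectedFamily 𝒦)
    (hlink : ∀ v, {v} ∈ 𝒦 → DisjointMinNonfaces (linkFamily 𝒦 {v})) {A B : Finset V}
    (hA : IsMinNonface 𝒦 A) (hB : IsMinNonface 𝒦 B) (hA3 : 3 ≤ #A) (hB3 : 3 ≤ #B) {v : V}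
    (hvA : v ∈ A) (hvB : v ∈ B) : A = B := by
  by_contra hne
  have hdis : Disjoint (A.erase v) (B.erase v) := by
    refine (hlink v (hA.2 v hvA)) (hA.erase h𝒦 hA3 hvA) (hB.erase h𝒦 hB3 hvB) fun h => hne ?_
    have h : A.erase v = B.erase v := h
    rw [← Finset.insert_erase hvA, h, Finset.insert_erase hvB]
  rw [Finset.disjoint_left] at hdis
  obtain ⟨a, ha, a', ha', haa'⟩ := Finset.one_lt_card.1
    (show 1 < #(A.erase v) by rw [Finset.card_erase_of_mem hvA]; omega)
  obtain ⟨b, hb, b', hb', hbb'⟩ := Finset.one_lt_card.1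
    (show 1 < #(B.erase v) by rw [Finset.card_erase_of_mem hvB]; omega)
  have haA : a ∈ A := by grind
  have haB : a ∉ B := by grind
  have hadj : ∀ c ∈ B, {a, c} ∈ 𝒦 := fun c hc =>
    hB.pair_mem h𝒦 hconn hlink hB3 (hA.2 a haA) hc
  obtain ⟨B', hB'B, hB'⟩ := exists_isMinNonface_linkFamily h𝒦 haB hadj
    (fun h => hB.1.prop (h𝒦 (by grind) h))
  have hvB' : v ∉ B' := by
    intro hv
    have := (hlink a (hA.2 a haA)).eq (hA.erase h𝒦 hA3 haA) hB' (c := v) (by grind) hv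
    have : a' ∈ B' := this ▸ (by grind)
    exact hdis ha' (by grind)
  -- So `B` stays a nonface when `v` is replaced by `a`; look at this from the link of `b`.
  have hins : insert b (insert a ((B.erase v).erase b)) ∉ 𝒦 := fun h =>
    hB'.1.prop ⟨Finset.disjoint_singleton_right.2 fun h' => haB (hB'B h'), h𝒦 (by
      clear hlink hconn hdis hadj; grind) h⟩
  have hbB : b ∈ B := by grind
  obtain ⟨C, hCsub, hC⟩ := exists_isMinNonface_linkFamily h𝒦 (x := b) (by grind) (by
    intro c hc
    rcases Finset.mem_insert.1 hc with rfl | hc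
    · exact Finset.pair_comm c b ▸ hadj b hbB
    · exact Finset.pair_comm c b ▸ hB.pair_mem h𝒦 hconn hlink hB3 (hB.2 c (by grind)) hbB) hins
  have hCa : C ⊆ {a} := by
    intro c hc
    by_contra hca
    have := (hlink b (hB.2 b hbB)).eq (hB.erase h𝒦 hB3 hbB) hC (c := c) (by grind) hc
    have : v ∈ C := this ▸ (by grind)
    grind
  exact hC.1.prop (isLowerSet_linkFamily h𝒦 _ hCa (singleton_mem_linkFamily (by grind)
    (Finset.pair_comm a b ▸ hadj b hbB)))

/-- A connected complex in which every edge lies in a triangle and whose vertex links have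
pairwise disjoint minimal nonfaces has itself pairwise disjoint minimal nonfaces. -/
theorem disjointMinNonfaces_of_vertex_links (h𝒦 : IsLowerSet 𝒦) (hconn : ConnectedFamily 𝒦)
    (htri : ∀ v w, v ≠ w → {v, w} ∈ 𝒦 → ∃ z, z ≠ v ∧ z ≠ w ∧ {v, w, z} ∈ 𝒦)
    (hlink : ∀ v, {v} ∈ 𝒦 → DisjointMinNonfaces (linkFamily 𝒦 {v})) :
    DisjointMinNonfaces 𝒦 := by
  have hpair : ∀ N, IsMinNonface 𝒦 N → ¬ 3 ≤ #N → ∀ v ∈ N, ∃ w, N = {v, w} := by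
    intro N hN hN3 v hv
    have h0 : ∅ ∈ 𝒦 := h𝒦 (by simp) (hN.2 v hv)
    have := hN.two_le_card h0
    have h1 : #(N.erase v) = 1 := by rw [Finset.card_erase_of_mem hv]; omega
    obtain ⟨w, hw⟩ := Finset.card_eq_one.1 h1
    exact ⟨w, by rw [← Finset.insert_erase hv, hw]⟩
  -- A missing edge cannot meet a larger minimal nonface.
  have hmixed : ∀ A B, IsMinNonface 𝒦 A → IsMinNonface 𝒦 B → ∀ v ∈ A, v ∈ B → ¬ 3 ≤ #A →
      3 ≤ #B → A = B := by
    intro A B hA hB v hvA hvB hA3 hB3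
    obtain ⟨w, rfl⟩ := hpair A hA hA3 v hvA
    exact absurd (Finset.pair_comm v w ▸ hB.pair_mem h𝒦 hconn hlink hB3 (hA.2 w (by simp)) hvB)
      hA.1.prop
  intro A hA B hB hne
  by_contra hdis
  obtain ⟨v, hvA, hvB⟩ := Finset.not_disjoint_iff.1 hdis
  refine hne ?_
  by_cases hA3 : 3 ≤ #A <;> by_cases hB3 : 3 ≤ #B
  · exact eq_of_isMinNonface_of_three_le_card h𝒦 hconn hlink hA hB hA3 hB3 hvA hvB
  · exact (hmixed B A hB hA v hvB hvA hB3 hA3).symm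
  · exact hmixed A B hA hB v hvA hvB hA3 hB3
  · obtain ⟨w, rfl⟩ := hpair A hA hA3 v hvA
    obtain ⟨u, rfl⟩ := hpair B hB hB3 v hvB
    rw [eq_of_pair_notMem h𝒦 hconn htri hlink (hA.2 v hvA) (hA.2 w (by simp)) (hB.2 u (by simp))
      hA.1.prop hB.1.prop]

end VertexLinks

/-! ### Purity and reduction to one-dimensional links -/

section Pure

variable [Fintype V] {𝒦 : Set (Finset V)}

/-- If all links of dimension at least one are connected, all facets have the same cardinality.
The induction takes a pair of facets of different cardinality with the largest intersection and
disconnects the link of that intersection. -/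
theorem card_eq_of_maximal (h𝒦 : IsLowerSet 𝒦)
    (hconn : ∀ F ∈ 𝒦, (∃ G ∈ 𝒦, F ⊆ G ∧ #F + 2 ≤ #G) → ConnectedFamily (linkFamily 𝒦 F))
    {G H : Finset V} (hG : Maximal (· ∈ 𝒦) G) (hH : Maximal (· ∈ 𝒦) H) : #G = #H := by
  suffices h : ∀ k, ∀ G H, Maximal (· ∈ 𝒦) G → Maximal (· ∈ 𝒦) H →
      Fintype.card V ≤ #(G ∩ H) + k → #G = #H from h _ G H hG hH le_add_self
  intro k
  induction k with
  | zero =>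
    intro G H _ _ hc
    have : G ∩ H = Finset.univ := Finset.eq_univ_of_card _ (le_antisymm (Finset.card_le_univ _) hc)
    have hG : G = Finset.univ := Finset.univ_subset_iff.1 (this ▸ Finset.inter_subset_left)
    have hH : H = Finset.univ := Finset.univ_subset_iff.1 (this ▸ Finset.inter_subset_right)
    rw [hG, hH]
  | succ k ih =>
    intro G H hG hH hc
    wlog hlt : #G < #H generalizing G H
    · rcases (not_lt.1 hlt).lt_or_eq with h | h
      · exact (this H G hH hG (Finset.inter_comm G H ▸ hc) h).symm
      · exact h.symm
    exfalso
    have hGH : ∃ g ∈ G, g ∉ H := by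
      by_contra! hsub
      exact hlt.ne (congrArg card (hG.eq_of_le hH.prop hsub))
    obtain ⟨g, hgG, hgH⟩ := hGH
    have hHG : ∃ h ∈ H, h ∉ G := by
      by_contra! hsub
      exact hlt.not_ge (Finset.card_le_card hsub)
    obtain ⟨h, hhH, hhG⟩ := hHG
    have hF : #(G ∩ H) + 1 ≤ #G :=
      Finset.card_lt_card (Finset.ssubset_iff_subset_ne.2 ⟨Finset.inter_subset_left, by grind⟩)
    have hbig : ∀ v ∉ G ∩ H, ∀ K K' : Finset V, insert v (G ∩ H) ⊆ K → insert v (G ∩ H) ⊆ K' →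
        Maximal (· ∈ 𝒦) K → Maximal (· ∈ 𝒦) K' → #K = #K' := by
      intro v hv K K' h1 h2 hK hK'
      refine ih K K' hK hK' ?_
      have := Finset.card_le_card (Finset.subset_inter h1 h2)
      rw [Finset.card_insert_of_notMem hv] at this
      omega
    have hhH' : insert h (G ∩ H) ⊆ H := Finset.insert_subset hhH Finset.inter_subset_right
    have hgG' : insert g (G ∩ H) ⊆ G := Finset.insert_subset hgG Finset.inter_subset_left
    have hh : h ∉ G ∩ H := fun h' => hhG (Finset.mem_inter.1 h').1
    have hg : g ∉ G ∩ H := fun h' => hgH (Finset.mem_inter.1 h').2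
    -- Vertices of the link of `G ∩ H` lying in facets of size `#H` are not joined to the others.
    have hS := hconn (G ∩ H) (h𝒦 Finset.inter_subset_left hG.prop)
      ⟨H, hH.prop, Finset.inter_subset_right, by omega⟩
      {v | ∃ K, Maximal (· ∈ 𝒦) K ∧ insert v (G ∩ H) ⊆ K ∧ #K = #H}
      ⟨h, ⟨H, hH, hhH', rfl⟩, Finset.disjoint_singleton_left.2 hh, h𝒦 hhH' hH.prop⟩ (by
        rintro v ⟨K, hK, hvK, hKH⟩ w ⟨hd, hw⟩
        obtain ⟨K', hK', hmax⟩ := exists_maximal_ge_of_wellFoundedGT (· ∈ 𝒦) _ hw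
        have hv : v ∉ G ∩ H := Finset.disjoint_left.1 hd (Finset.mem_insert_self _ _)
        have hvK' : insert v (G ∩ H) ⊆ K' := Finset.insert_subset
          (hK' (by simp)) (Finset.subset_union_right.trans hK')
        have hwK' : insert w (G ∩ H) ⊆ K' := Finset.insert_subset
          (hK' (by simp)) (Finset.subset_union_right.trans hK')
        exact ⟨K', hmax, hwK', hKH ▸ hbig v hv K' K hvK' hvK hmax hK⟩) g
      ⟨Finset.disjoint_singleton_left.2 hg, h𝒦 hgG' hG.prop⟩
    obtain ⟨K, hK, hgK, hKH⟩ := hS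
    have := hbig g hg K G hgK hgG' hK hG
    omega

/-- For a complex of dimension at least two all of whose links of dimension at least one are
connected, disjointness of minimal nonfaces can be checked on the one-dimensional links. -/
theorem disjointMinNonfaces_of_one_dim_links (h𝒦 : IsLowerSet 𝒦) {H : Finset V} (hH : H ∈ 𝒦)
    (hH3 : 3 ≤ #H)
    (hconn : ∀ F ∈ 𝒦, (∃ G ∈ 𝒦, F ⊆ G ∧ #F + 2 ≤ #G) → ConnectedFamily (linkFamily 𝒦 F))
    (hlink : ∀ F ∈ 𝒦, (∃ G ∈ linkFamily 𝒦 F, #G = 2) → (∀ G ∈ linkFamily 𝒦 F, #G ≤ 2) →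
      DisjointMinNonfaces (linkFamily 𝒦 F)) :
    DisjointMinNonfaces 𝒦 := by
  obtain ⟨D, hHD, hD⟩ := exists_maximal_ge_of_wellFoundedGT (· ∈ 𝒦) H hH
  have hD3 := hH3.trans (Finset.card_le_card hHD)
  have hext : ∀ F ∈ 𝒦, ∃ G ∈ 𝒦, F ⊆ G ∧ #G = #D := by
    intro F hF
    obtain ⟨G, hFG, hG⟩ := exists_maximal_ge_of_wellFoundedGT (· ∈ 𝒦) F hF
    exact ⟨G, hG.prop, hFG, card_eq_of_maximal h𝒦 hconn hG hD⟩
  have hle : ∀ F ∈ 𝒦, #F ≤ #D := by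
    intro F hF
    obtain ⟨G, _, hFG, hG⟩ := hext F hF
    exact hG ▸ Finset.card_le_card hFG
  suffices h : ∀ k, ∀ F ∈ 𝒦, #F + 2 + k = #D → DisjointMinNonfaces (linkFamily 𝒦 F) by
    simpa using h (#D - 2) ∅ (h𝒦 (Finset.empty_subset _) hH) (by simp; omega)
  intro k
  induction k with
  | zero =>
    intro F hF hcard
    obtain ⟨G, hG, hFG, hGD⟩ := hext F hF
    refine hlink F hF ⟨G \ F, ⟨Finset.sdiff_disjoint, ?_⟩, ?_⟩ ?_
    · rwa [Finset.sdiff_union_of_subset hFG]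
    · rw [Finset.card_sdiff_of_subset hFG]; omega
    · rintro A ⟨hd, hA⟩
      have := hle _ hA
      rw [Finset.card_union_of_disjoint hd] at this
      omega
  | succ k ih =>
    intro F hF hcard
    refine disjointMinNonfaces_of_vertex_links (isLowerSet_linkFamily h𝒦 F) ?_ ?_ ?_
    · obtain ⟨G, hG, hFG, hGD⟩ := hext F hF
      exact hconn F hF ⟨G, hG, hFG, by omega⟩
    · rintro v w hvw ⟨hd, hvwF⟩
      obtain ⟨G, hG, hFG, hGD⟩ := hext _ hvwF
      obtain ⟨z, hzG, hz⟩ := Finset.exists_mem_notMem_of_card_lt_card (s := {v, w} ∪ F) (t := G) (by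
        rw [Finset.card_union_of_disjoint hd, Finset.card_pair hvw]; omega)
      have hzF : z ∉ F := fun h => hz (Finset.mem_union_right _ h)
      refine ⟨z, by rintro rfl; simp at hz, by rintro rfl; simp at hz, ?_, h𝒦 ?_ hG⟩
      · simp only [Finset.disjoint_insert_left, Finset.disjoint_singleton_left] at hd ⊢
        exact ⟨hd.1, hd.2, hzF⟩
      · simp only [Finset.union_subset_iff, Finset.insert_subset_iff,
          Finset.singleton_subset_iff] at hFG
        simp only [Finset.union_subset_iff, Finset.insert_subset_iff,
          Finset.singleton_subset_iff]
        exact ⟨⟨hFG.1.1, hFG.1.2, hzG⟩, hFG.2⟩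
    · rintro v ⟨hd, hv⟩
      rw [linkFamily_linkFamily 𝒦 hd.symm]
      refine ih _ (Finset.union_comm {v} F ▸ hv) ?_
      rw [Finset.card_union_of_disjoint hd.symm, Finset.card_singleton]
      omega

end Pure

end Combinatorics

/-! ### Squarefree monomial ideals -/

section MonomialIdeals

open MvPolynomial

variable {σ : Type*} (K : Type*) [Field K]

/-- The exponent vector of the squarefree monomial with support `N`. -/
noncomputable def sqfreeExponent (N : Finset σ) : σ →₀ ℕ := ∑ v ∈ N, Finsupp.single v 1

theorem sqfreeExponent_apply [DecidableEq σ] (N : Finset σ) (v : σ) :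
    sqfreeExponent N v = if v ∈ N then 1 else 0 := by
  simp [sqfreeExponent, Finsupp.finsetSum_apply, Finsupp.single_apply]

theorem support_sqfreeExponent (N : Finset σ) : (sqfreeExponent N).support = N := by
  classical
  ext v
  simp [sqfreeExponent_apply]

theorem sqfreeExponent_injective : Function.Injective (sqfreeExponent (σ := σ)) := fun N M h => by
  rw [← support_sqfreeExponent N, h, support_sqfreeExponent]

theorem sqfreeExponent_le_iff {N : Finset σ} {e : σ →₀ ℕ} :
    sqfreeExponent N ≤ e ↔ N ⊆ e.support := by
  classical
  refine ⟨fun h => support_sqfreeExponent N ▸ Finsupp.support_mono h, fun h v => ?_⟩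
  rw [sqfreeExponent_apply]
  split_ifs with hv
  · exact Nat.one_le_iff_ne_zero.2 (Finsupp.mem_support_iff.1 (h hv))
  · exact Nat.zero_le _

theorem eq_sqfreeExponent_support {N : Finset σ} {e : σ →₀ ℕ} (h : e ≤ sqfreeExponent N) :
    e = sqfreeExponent e.support := by
  classical
  ext v
  have := h v
  rw [sqfreeExponent_apply] at this ⊢
  simp only [Finsupp.mem_support_iff]
  split_ifs at this ⊢ <;> omega

theorem monomial_sqfreeExponent (N : Finset σ) :
    monomial (sqfreeExponent N) (1 : K) = ∏ v ∈ N, X v := by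
  rw [sqfreeExponent, monomial_sum_one]
  rfl

variable {K} in
theorem mem_span_prod_X_iff {S : Set (Finset σ)} {f : MvPolynomial σ K} :
    f ∈ Ideal.span ((fun N : Finset σ => ∏ v ∈ N, (X v : MvPolynomial σ K)) '' S) ↔
      ∀ e ∈ f.support, ∃ N ∈ S, N ⊆ e.support := by
  have h : (fun N : Finset σ => ∏ v ∈ N, (X v : MvPolynomial σ K)) '' S =
      (fun s => monomial s (1 : K)) '' (sqfreeExponent '' S) := by
    rw [Set.image_image]
    exact Set.image_congr fun N _ => (monomial_sqfreeExponent K N).symm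
  rw [h, mem_ideal_span_monomial_image]
  simp [sqfreeExponent_le_iff]

/-- The squarefree monomial ideal generated by the monomials supported on the sets outside `𝒦`. -/
noncomputable def nonfaceIdeal (𝒦 : Set (Finset σ)) : Ideal (MvPolynomial σ K) :=
  Ideal.span {m | ∃ F : Finset σ, F ∉ 𝒦 ∧ m = ∏ v ∈ F, X v}

variable {K}

theorem prod_X_mem_nonfaceIdeal {𝒦 : Set (Finset σ)} {N : Finset σ} (hN : N ∉ 𝒦) :
    ∏ v ∈ N, (X v : MvPolynomial σ K) ∈ nonfaceIdeal K 𝒦 :=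
  Ideal.subset_span ⟨N, hN, rfl⟩

theorem mem_nonfaceIdeal_iff {𝒦 : Set (Finset σ)} (h𝒦 : IsLowerSet 𝒦) {f : MvPolynomial σ K} :
    f ∈ nonfaceIdeal K 𝒦 ↔ ∀ e ∈ f.support, e.support ∉ 𝒦 := by
  have h : {m | ∃ F : Finset σ, F ∉ 𝒦 ∧ m = ∏ v ∈ F, X v} =
      (fun N : Finset σ => ∏ v ∈ N, (X v : MvPolynomial σ K)) '' 𝒦ᶜ := by
    ext m
    simp [eq_comm]
  rw [nonfaceIdeal, h, mem_span_prod_X_iff]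
  exact forall₂_congr fun e _ => ⟨fun ⟨N, hN, hNe⟩ he => hN (h𝒦 hNe he), fun he => ⟨_, he, le_rfl⟩⟩

theorem nonfaceIdeal_eq_span_minNonfaces {𝒦 : Set (Finset σ)} (h𝒦 : IsLowerSet 𝒦)
    (hv : ∀ v, {v} ∈ 𝒦) : nonfaceIdeal K 𝒦 =
      Ideal.span ((fun N : Finset σ => ∏ v ∈ N, (X v : MvPolynomial σ K)) ''
        {N | IsMinNonface 𝒦 N}) := by
  ext f
  rw [mem_nonfaceIdeal_iff h𝒦, mem_span_prod_X_iff]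
  refine forall₂_congr fun e _ => ⟨fun he => ?_, fun ⟨N, hN, hNe⟩ he => hN.1.prop (h𝒦 hNe he)⟩
  obtain ⟨N, hNe, hN⟩ := exists_isMinNonface_subset he fun v _ => hv v
  exact ⟨N, hN, hNe⟩

/-- The coefficient of a minimal generator is a linear functional on the ideal that kills the
multiples by polynomials without constant term. -/
theorem coeff_mul_of_minimal_nonface {𝒦 : Set (Finset σ)} (h𝒦 : IsLowerSet 𝒦) {N : Finset σ}
    (hN : Minimal (· ∉ 𝒦) N) (c : MvPolynomial σ K) {f : MvPolynomial σ K}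
    (hf : f ∈ nonfaceIdeal K 𝒦) :
    coeff (sqfreeExponent N) (c * f) = constantCoeff c * coeff (sqfreeExponent N) f := by
  classical
  rw [coeff_mul, Finset.sum_eq_single (0, sqfreeExponent N)]
  · rfl
  · rintro ⟨a, b⟩ hab hne
    -- A proper divisor of the monomial is supported on a face, so it does not occur in `f`.
    rw [Finset.HasAntidiagonal.mem_antidiagonal] at hab
    have hle : b ≤ sqfreeExponent N := hab ▸ le_add_self
    have hb := eq_sqfreeExponent_support hle
    suffices h : coeff b f = 0 by simp [h]
    by_contra hcoeff
    have hnot := (mem_nonfaceIdeal_iff h𝒦).1 hf b (mem_support_iff.2 hcoeff)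
    have hsub : b.support ⊆ N := support_sqfreeExponent N ▸ Finsupp.support_mono hle
    have hbN : b = sqfreeExponent N := by
      rw [hb, hN.eq_of_le hnot hsub]
    refine hne ?_
    rw [hbN] at hab ⊢
    simpa using hab
  · simp

theorem coeff_sqfreeExponent_prod_X [DecidableEq σ] (N M : Finset σ) :
    coeff (sqfreeExponent N) (∏ v ∈ M, (X v : MvPolynomial σ K)) = if M = N then 1 else 0 := by
  rw [← monomial_sqfreeExponent, coeff_monomial]
  exact if_congr sqfreeExponent_injective.eq_iff rfl rfl

/-- Squarefree monomials with pairwise disjoint supports form a regular sequence. -/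
theorem isWeaklyRegular_prod_X (ns : List (Finset σ)) (hns : ns.Pairwise Disjoint) :
    RingTheory.Sequence.IsWeaklyRegular (MvPolynomial σ K)
      (ns.map fun N => ∏ v ∈ N, (X v : MvPolynomial σ K)) := by
  classical
  rw [RingTheory.Sequence.isWeaklyRegular_iff]
  intro i hi
  rw [isSMulRegular_quotient_iff_mem_of_smul_mem]
  have hi' : i < ns.length := by simpa using hi
  have hspan : (Ideal.ofList (List.take i (ns.map fun N => ∏ v ∈ N, (X v : MvPolynomial σ K))) •
      ⊤ : Ideal (MvPolynomial σ K)) =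
      Ideal.span ((fun N : Finset σ => ∏ v ∈ N, (X v : MvPolynomial σ K)) ''
        {N | N ∈ ns.take i}) := by
    rw [smul_eq_mul, Ideal.mul_top, Ideal.ofList]
    congr 1
    ext
    simp only [← List.map_take, List.mem_map, Set.mem_image, Set.mem_ofPred_eq]
  intro f hf
  rw [hspan, mem_span_prod_X_iff] at hf ⊢
  intro e he
  have hmem : sqfreeExponent ns[i] + e ∈
      ((ns.map fun N => ∏ v ∈ N, (X v : MvPolynomial σ K))[i] • f).support := by
    rw [List.getElem_map, ← monomial_sqfreeExponent, smul_eq_mul, mem_support_iff,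
      coeff_monomial_mul, one_mul]
    exact mem_support_iff.1 he
  obtain ⟨N, hN, hNe⟩ := hf _ hmem
  refine ⟨N, hN, fun v hv => ?_⟩
  have hdis : Disjoint N ns[i] := by
    obtain ⟨j, hj, rfl⟩ := List.mem_iff_getElem.1 hN
    rw [List.getElem_take]
    exact List.pairwise_iff_getElem.1 hns j i (by simp at hj; omega) hi' (by simp at hj; omega)
  have h1 := Finsupp.mem_support_iff.1 (hNe hv)
  rw [Finsupp.add_apply, sqfreeExponent_apply, if_neg (Finset.disjoint_left.1 hdis hv),
    zero_add] at h1
  exact Finsupp.mem_support_iff.2 h1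

/-- If the minimal nonfaces are pairwise disjoint, the minimal generators form a regular
sequence. -/
theorem DisjointMinNonfaces.isCompleteIntersection_nonfaceIdeal [Finite σ]
    {𝒦 : Set (Finset σ)} (h𝒦 : IsLowerSet 𝒦) (h0 : ∅ ∈ 𝒦) (hv : ∀ v, {v} ∈ 𝒦)
    (h : DisjointMinNonfaces 𝒦) : (nonfaceIdeal K 𝒦).IsCompleteIntersection := by
  classical
  let ns := (Set.toFinite {N | IsMinNonface 𝒦 N}).toFinset.toList
  have hns : Ideal.ofList (ns.map fun N => ∏ v ∈ N, (X v : MvPolynomial σ K)) =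
      nonfaceIdeal K 𝒦 := by
    rw [nonfaceIdeal_eq_span_minNonfaces h𝒦 hv, Ideal.ofList]
    congr 1
    ext
    simp [ns]
  refine ⟨_, ⟨isWeaklyRegular_prod_X ns ?_, ?_⟩, hns⟩
  · refine (Finset.nodup_toList _).imp_of_mem ?_
    intro A B hA hB hne
    simp only [Finset.mem_toList, Set.Finite.mem_toFinset] at hA hB
    exact h hA hB hne
  · rw [hns, smul_eq_mul, Ideal.mul_top]
    intro htop
    have h1 : (1 : MvPolynomial σ K) ∈ nonfaceIdeal K 𝒦 := htop ▸ trivial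
    exact (mem_nonfaceIdeal_iff h𝒦).1 h1 0 (by simp) (by simpa using h0)

/-! ### Face primes of Stanley-Reisner rings -/

section FacePrimes

variable {𝒦 : Set (Finset σ)}

open Classical in
/-- The projection of the Stanley-Reisner ring onto the polynomial ring on the vertices of a
face `F`; it sends the remaining variables to zero. The target is taken to be the polynomial ring
on all vertices, so that it does not depend on `F`. -/
noncomputable def faceEval (h𝒦 : IsLowerSet 𝒦) {F : Finset σ} (hF : F ∈ 𝒦) :
    MvPolynomial σ K ⧸ nonfaceIdeal K 𝒦 →ₐ[K] MvPolynomial σ K :=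
  Ideal.Quotient.liftₐ _ (aeval fun v => if v ∈ F then X v else 0) (by
    suffices h : nonfaceIdeal K 𝒦 ≤ RingHom.ker
        (aeval (R := K) fun v => if v ∈ F then (X v : MvPolynomial σ K) else 0) from
      fun a ha => h ha
    refine Ideal.span_le.2 ?_
    rintro _ ⟨N, hN, rfl⟩
    obtain ⟨v, hvN, hvF⟩ := Finset.not_subset.1 fun h => hN (h𝒦 h hF)
    simp only [SetLike.mem_coe, RingHom.mem_ker, map_prod, aeval_X]
    exact Finset.prod_eq_zero hvN (by simp [hvF]))

theorem faceEval_X [DecidableEq σ] (h𝒦 : IsLowerSet 𝒦) {F : Finset σ} (hF : F ∈ 𝒦) (v : σ) :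
    faceEval (K := K) h𝒦 hF (Ideal.Quotient.mk _ (X v)) = if v ∈ F then X v else 0 := by
  change aeval _ (X v) = _
  rw [aeval_X]
  congr

/-- The projection to a face factors through the projection to any larger face. -/
theorem faceEval_comp (h𝒦 : IsLowerSet 𝒦) {F G : Finset σ} (hF : F ∈ 𝒦) (hG : G ∈ 𝒦) (hFG : F ⊆ G)
    (x : MvPolynomial σ K ⧸ nonfaceIdeal K 𝒦) :
    faceEval h𝒦 hF (Ideal.Quotient.mk _ (faceEval h𝒦 hG x)) = faceEval h𝒦 hF x := by
  classical
  obtain ⟨p, rfl⟩ := Ideal.Quotient.mk_surjective x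
  induction p using MvPolynomial.induction_on with
  | C a =>
    have h : ∀ {H : Finset σ} (hH : H ∈ 𝒦), faceEval (K := K) h𝒦 hH (Ideal.Quotient.mk _ (C a)) =
      C a := fun hH => (faceEval (K := K) h𝒦 hH).commutes a
    rw [h, h]
  | add p q hp hq => simp only [map_add, hp, hq]
  | mul_X p v hp =>
    simp only [map_mul, hp, faceEval_X]
    by_cases hv : v ∈ F
    · rw [if_pos (hFG hv), if_pos hv, faceEval_X, if_pos hv]
    · by_cases hv' : v ∈ G
      · rw [if_pos hv', faceEval_X, if_neg hv]
      · rw [if_neg hv', if_neg hv, map_zero, map_zero]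

variable {B : Type*} [CommRing B] (π : B →+* MvPolynomial σ K ⧸ nonfaceIdeal K 𝒦)

/-- The prime of `B` that corresponds to the face `F`, for a ring `B` with a homomorphism to the
Stanley-Reisner ring: the contraction of the prime generated by the variables outside `F`. -/
noncomputable def facePrime (h𝒦 : IsLowerSet 𝒦) {F : Finset σ} (hF : F ∈ 𝒦) : Ideal B :=
  RingHom.ker ((faceEval (K := K) h𝒦 hF).toRingHom.comp π)

theorem mem_facePrime (h𝒦 : IsLowerSet 𝒦) {F : Finset σ} (hF : F ∈ 𝒦) {b : B} :
    b ∈ facePrime π h𝒦 hF ↔ faceEval h𝒦 hF (π b) = 0 := Iff.rfl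

instance facePrime_isPrime (h𝒦 : IsLowerSet 𝒦) {F : Finset σ} (hF : F ∈ 𝒦) :
    (facePrime π h𝒦 hF).IsPrime :=
  RingHom.ker_isPrime _

theorem facePrime_le (h𝒦 : IsLowerSet 𝒦) {F G : Finset σ} (hF : F ∈ 𝒦) (hG : G ∈ 𝒦) (hFG : F ⊆ G) :
    facePrime π h𝒦 hG ≤ facePrime π h𝒦 hF := fun b hb => by
  rw [mem_facePrime] at hb ⊢
  rw [← faceEval_comp h𝒦 hF hG hFG, hb, map_zero, map_zero]

variable {π} in
theorem facePrime_lt (hπ : Function.Surjective π) (h𝒦 : IsLowerSet 𝒦) {F G : Finset σ} (hF : F ∈ 𝒦)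
    (hG : G ∈ 𝒦) (hFG : F ⊂ G) : facePrime π h𝒦 hG < facePrime π h𝒦 hF := by
  classical
  obtain ⟨v, hvG, hvF⟩ := Finset.exists_of_ssubset hFG
  obtain ⟨b, hb⟩ := hπ (Ideal.Quotient.mk _ (X v))
  refine lt_of_le_not_ge (facePrime_le π h𝒦 hF hG hFG.1) fun hle => ?_
  have : b ∈ facePrime π h𝒦 hG :=
    hle ((mem_facePrime π h𝒦 hF).2 (by rw [hb, faceEval_X, if_neg hvF]))
  rw [mem_facePrime, hb, faceEval_X, if_pos hvG] at this
  exact X_ne_zero v this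

variable {π} in
/-- The primes of the faces between `F` and `G` form a chain of length `#G - #F`. -/
theorem height_facePrime_add_le (hπ : Function.Surjective π) (h𝒦 : IsLowerSet 𝒦) {F G : Finset σ}
    (hF : F ∈ 𝒦) (hG : G ∈ 𝒦) (hFG : F ⊆ G) {n : ℕ} (hn : G.card = F.card + n) :
    (facePrime π h𝒦 hG).height + n ≤ (facePrime π h𝒦 hF).height := by
  classical
  induction n generalizing F with
  | zero =>
    obtain rfl := Finset.eq_of_subset_of_card_le hFG (by omega)
    simp
  | succ n ih =>
    obtain ⟨v, hvG, hvF⟩ := Finset.exists_mem_notMem_of_card_lt_card (s := F) (t := G) (by omega)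
    have hF' : insert v F ∈ 𝒦 := h𝒦 (Finset.insert_subset hvG hFG) hG
    have h1 := ih hF' (Finset.insert_subset hvG hFG)
      (by rw [Finset.card_insert_of_notMem hvF]; omega)
    have h2 := Ideal.height_add_one_le_of_lt_of_isPrime
      (facePrime_lt hπ h𝒦 hF hF' (Finset.ssubset_insert hvF))
    refine le_trans ?_ h2
    rw [Nat.cast_add, Nat.cast_one, ← add_assoc]
    gcongr

end FacePrimes

end MonomialIdeals

/-! ### Complete intersection presentations of Stanley-Reisner rings -/

section Presentations

open MvPolynomial

/-- A regular sequence contained in a prime ideal is no longer than its height. -/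
theorem length_le_height_of_isWeaklyRegular {A : Type*} [CommRing A] [IsNoetherianRing A]
    {rs : List A} (reg : RingTheory.Sequence.IsWeaklyRegular A rs) (Q : Ideal A) [Q.IsPrime]
    (h : ∀ r ∈ rs, r ∈ Q) : (rs.length : ℕ∞) ≤ Q.height := by
  have hreg := reg.isRegular_of_isLocalization_of_mem (Localization.AtPrime Q) Q h
  have hdim := ringKrullDim_add_length_eq_ringKrullDim_of_isRegular _ hreg
  have hnt : Nontrivial (Localization.AtPrime Q ⧸
      Ideal.ofList (rs.map (algebraMap A (Localization.AtPrime Q)))) :=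
    Ideal.Quotient.nontrivial_iff.2 fun h => hreg.top_ne_smul (by simp [h])
  rw [IsLocalization.AtPrime.ringKrullDim_eq_height Q (Localization.AtPrime Q),
    List.length_map] at hdim
  rw [← WithBot.coe_le_coe, ← hdim]
  exact le_add_of_nonneg_left ringKrullDim_nonneg_of_nontrivial

/-- If `J_P` is generated by `rs`, then `J` contains as many elements generating `J` up to
multipliers outside `P`. -/
theorem exists_numerators {D : Type*} [CommRing D] [IsDomain D] (P J : Ideal D) [P.IsPrime]
    {rs : List (Localization.AtPrime P)}
    (hrs : Ideal.ofList rs = J.map (algebraMap D (Localization.AtPrime P))) :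
    ∃ js : Fin rs.length → D, (∀ k, js k ∈ J) ∧
      ∀ j ∈ J, ∃ s ∉ P, s * j ∈ Ideal.span (Set.range js) := by
  have hmem : ∀ k : Fin rs.length, ∃ j ∈ J, ∃ s : P.primeCompl,
      rs[k] * algebraMap D _ s = algebraMap D (Localization.AtPrime P) j := by
    intro k
    have hk : rs[k] ∈ J.map (algebraMap D (Localization.AtPrime P)) :=
      hrs ▸ Ideal.subset_span (List.getElem_mem _)
    obtain ⟨⟨⟨j, hj⟩, s⟩, h⟩ := (IsLocalization.mem_map_algebraMap_iff P.primeCompl _).1 hk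
    exact ⟨j, hj, s, h⟩
  choose js hjs s hs using hmem
  refine ⟨js, hjs, fun j hj => ?_⟩
  have hle : Ideal.ofList rs ≤
      (Ideal.span (Set.range js)).map (algebraMap D (Localization.AtPrime P)) := by
    refine Ideal.span_le.2 fun r hr => ?_
    obtain ⟨k, hk, rfl⟩ := List.mem_iff_getElem.1 hr
    have hunit := IsLocalization.map_units (Localization.AtPrime P) (s ⟨k, hk⟩)
    refine (Ideal.mul_unit_mem_iff_mem _ hunit).1 ?_
    have := hs ⟨k, hk⟩
    rw [Fin.getElem_fin] at this
    rw [this]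
    exact Ideal.mem_map_of_mem _ (Ideal.subset_span ⟨_, rfl⟩)
  have hj' := hle (hrs ▸ Ideal.mem_map_of_mem _ hj)
  obtain ⟨⟨⟨t, ht⟩, u⟩, h⟩ := (IsLocalization.mem_map_algebraMap_iff P.primeCompl _).1 hj'
  refine ⟨u, u.2, ?_⟩
  rw [← map_mul] at h
  have := IsLocalization.injective (Localization.AtPrime P) P.primeCompl_le_nonZeroDivisors h
  rw [mul_comm, this]
  exact ht

variable {σ : Type*} {K : Type*} [Field K]

/-- A `K`-linear map on an ideal which is semilinear along the constant coefficient maps the ideal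
generated by `T` into any subspace containing the image of `T`. -/
theorem map_mem_of_mem_span {τ W : Type*} [AddCommGroup W] [Module K W]
    {L : Ideal (MvPolynomial τ K)} (Λ : MvPolynomial τ K →ₗ[K] W)
    (hΛ : ∀ c, ∀ l ∈ L, Λ (c * l) = constantCoeff c • Λ l) {M : Submodule K W}
    {T : Set (MvPolynomial τ K)} (hTL : T ⊆ L) (hT : ∀ t ∈ T, Λ t ∈ M)
    {b : MvPolynomial τ K} (hb : b ∈ Ideal.span T) : Λ b ∈ M := by
  induction hb using Submodule.span_induction with
  | mem x hx => exact hT x hx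
  | zero => simp
  | add x y _ _ hx hy => rw [map_add]; exact M.add_mem hx hy
  | smul c x hxT hx =>
    rw [smul_eq_mul, hΛ c x (Ideal.span_le.2 hTL hxT)]
    exact M.smul_mem _ hx

section Comparison

variable {ι R : Type*} [CommRing R] [Algebra K R] (φ : MvPolynomial ι K →ₐ[K] R)
  (χ : MvPolynomial σ K →ₐ[K] R) (a : σ → MvPolynomial ι K) (b : ι → MvPolynomial σ K)

/-- The homomorphism `X i ↦ X i + b i` into the polynomial ring on both sets of variables. It is
compatible with `φ` and `projHom χ` when `b i` lifts `φ (X i)` along `χ`. -/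
noncomputable def shiftHom : MvPolynomial ι K →ₐ[K] MvPolynomial (ι ⊕ σ) K :=
  aeval fun i => X (Sum.inl i) + rename Sum.inr (b i)

/-- The extension of the presentation `χ` by redundant variables, all sent to zero. -/
noncomputable def projHom : MvPolynomial (ι ⊕ σ) K →ₐ[K] R :=
  aeval (Sum.elim (fun _ => 0) fun v => χ (X v))

theorem projHom_rename (p : MvPolynomial σ K) :
    projHom χ (rename (Sum.inr : σ → ι ⊕ σ) p) = χ p := by
  rw [projHom, aeval_rename, Sum.elim_comp_inr]
  exact DFunLike.congr_fun (aeval_unique χ).symm p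

variable {φ χ a b}

theorem projHom_shiftHom (hb : ∀ i, χ (b i) = φ (X i)) (p : MvPolynomial ι K) :
    projHom χ (shiftHom b p) = φ p := by
  have : (projHom χ).comp (shiftHom b) = φ := by
    ext i
    simp only [AlgHom.comp_apply, shiftHom, aeval_X, map_add, projHom_rename, hb]
    simp [projHom]
  exact DFunLike.congr_fun this p

/-- The kernel of `projHom χ` is generated by the image of the kernel of `φ` and one element for
each variable of `χ`. This compares two presentations of the same algebra. -/
theorem ker_projHom (hb : ∀ i, χ (b i) = φ (X i)) (ha : ∀ v, φ (a v) = χ (X v)) :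
    RingHom.ker (projHom (ι := ι) χ) = Ideal.span (shiftHom b '' (RingHom.ker φ) ∪
      Set.range fun v => X (Sum.inr v) - shiftHom b (a v)) := by
  set Q := Ideal.span (shiftHom b '' (RingHom.ker φ) ∪
      Set.range fun v => X (Sum.inr v) - shiftHom b (a v)) with hQ
  have hQle : Q ≤ RingHom.ker (projHom (ι := ι) χ) := by
    refine Ideal.span_le.2 (Set.union_subset ?_ ?_)
    · rintro _ ⟨j, hj, rfl⟩
      rw [SetLike.mem_coe, RingHom.mem_ker, projHom_shiftHom hb]
      exact hj
    · rintro _ ⟨v, rfl⟩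
      rw [SetLike.mem_coe, RingHom.mem_ker, map_sub, projHom_shiftHom hb, ha]
      simp [projHom]
  refine le_antisymm (fun y hy => ?_) hQle
  -- Modulo `Q`, the variables `X v` can be eliminated in favour of the `X i`.
  have h1 : ((Ideal.Quotient.mkₐ K Q).comp (rename Sum.inr) : MvPolynomial σ K →ₐ[K] _) =
      ((Ideal.Quotient.mkₐ K Q).comp (shiftHom b)).comp (aeval a) := by
    ext v
    simp only [AlgHom.comp_apply, rename_X, aeval_X, Ideal.Quotient.mkₐ_eq_mk]
    exact Ideal.Quotient.eq.2 (Ideal.subset_span (Or.inr ⟨v, rfl⟩))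
  let θ : MvPolynomial (ι ⊕ σ) K →ₐ[K] MvPolynomial ι K :=
    aeval (Sum.elim (fun i => X i - aeval a (b i)) a)
  have h2 : Ideal.Quotient.mkₐ K Q = ((Ideal.Quotient.mkₐ K Q).comp (shiftHom b)).comp θ := by
    ext (i | v)
    · have := DFunLike.congr_fun h1 (b i)
      simp only [AlgHom.comp_apply] at this
      simp only [AlgHom.comp_apply, θ, aeval_X, Sum.elim_inl, map_sub]
      rw [← this]
      simp [shiftHom]
    · have := DFunLike.congr_fun h1 (X v)
      simpa [θ] using this
  have hmem : y - shiftHom b (θ y) ∈ Q := Ideal.Quotient.eq.1 (DFunLike.congr_fun h2 y)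
  have hθ : θ y ∈ RingHom.ker φ := by
    have := hQle hmem
    rw [RingHom.mem_ker, map_sub, projHom_shiftHom hb, RingHom.mem_ker.1 hy, zero_sub,
      neg_eq_zero] at this
    exact this
  rw [← sub_add_cancel y (shiftHom b (θ y))]
  exact Q.add_mem hmem (Ideal.subset_span (Or.inl ⟨_, hθ, rfl⟩))

end Comparison

section Count

variable {𝒦 : Set (Finset σ)}

/-- The same faces on a larger ground set: no element of `ι` lies in a face. -/
def extendFamily (ι : Type*) (𝒦 : Set (Finset σ)) : Set (Finset (ι ⊕ σ)) :=
  {F | F.toLeft = ∅ ∧ F.toRight ∈ 𝒦}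

theorem isLowerSet_extendFamily {ι : Type*} (h𝒦 : IsLowerSet 𝒦) :
    IsLowerSet (extendFamily ι 𝒦) := fun _ _ hAB hA =>
  ⟨Finset.subset_empty.1 (hA.1 ▸ Finset.toLeft_monotone hAB),
    h𝒦 (Finset.toRight_monotone hAB) hA.2⟩

theorem minimal_singleton_inl {ι : Type*} (h0 : ∅ ∈ 𝒦) (i : ι) :
    Minimal (· ∉ extendFamily ι 𝒦) {Sum.inl i} := by
  refine minimal_iff_forall_lt.2 ⟨fun h => ?_, fun M hM h => h ?_⟩
  · have := h.1
    have h' : i ∈ Finset.toLeft ({Sum.inl i} : Finset (ι ⊕ σ)) := by simp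
    simp [this] at h'
  · rw [Finset.ssubset_singleton_iff.1 hM]
    exact ⟨by ext; simp, by convert h0; ext; simp⟩

theorem minimal_map_inr {ι : Type*} {N : Finset σ} (hN : IsMinNonface 𝒦 N) :
    Minimal (· ∉ extendFamily ι 𝒦) (N.map Function.Embedding.inr) := by
  refine minimal_iff_forall_lt.2 ⟨fun h => ?_, fun M hM h => h ?_⟩
  · refine hN.1.prop ?_
    convert h.2
    ext; simp
  · have hl : M.toLeft = ∅ := by
      ext i
      simp only [Finset.mem_toLeft, Finset.notMem_empty, iff_false]
      intro hi
      have := hM.1 hi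
      simp at this
    have hM' : M = M.toRight.map Function.Embedding.inr := by
      ext (i | v)
      · have : i ∉ M.toLeft := by simp [hl]
        simpa using this
      · simp
    refine ⟨hl, hN.mem_of_ssubset ?_⟩
    rw [hM'] at hM
    exact Finset.map_ssubset_map.1 hM

theorem ker_projHom_le {ι : Type*} :
    RingHom.ker (projHom (ι := ι) (Ideal.Quotient.mkₐ K (nonfaceIdeal K 𝒦))) ≤
      nonfaceIdeal K (extendFamily ι 𝒦) := by
  set L := nonfaceIdeal K (extendFamily ι 𝒦)
  let ρ : MvPolynomial (ι ⊕ σ) K →ₐ[K] MvPolynomial σ K := aeval (Sum.elim (fun _ => 0) X)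
  have h1 : projHom (Ideal.Quotient.mkₐ K (nonfaceIdeal K 𝒦)) =
      (Ideal.Quotient.mkₐ K (nonfaceIdeal K 𝒦)).comp ρ := by
    ext (i | v) <;> simp [projHom, ρ]
  have h2 : Ideal.Quotient.mkₐ K L = (Ideal.Quotient.mkₐ K L).comp ((rename Sum.inr).comp ρ) := by
    ext (i | v)
    · have hi : ({Sum.inl i} : Finset (ι ⊕ σ)) ∉ extendFamily ι 𝒦 := fun h => by
        have h' : i ∈ Finset.toLeft ({Sum.inl i} : Finset (ι ⊕ σ)) := by simp
        simp [h.1] at h'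
      have := prod_X_mem_nonfaceIdeal (K := K) hi
      rw [Finset.prod_singleton] at this
      simpa [ρ] using Ideal.Quotient.eq_zero_iff_mem.2 this
    · simp [ρ]
  have h3 : nonfaceIdeal K 𝒦 ≤ L.comap (rename Sum.inr) := by
    refine Ideal.span_le.2 ?_
    rintro _ ⟨N, hN, rfl⟩
    have hN' : N.map Function.Embedding.inr ∉ extendFamily ι 𝒦 := fun h => hN (by
      convert h.2
      ext; simp)
    have := prod_X_mem_nonfaceIdeal (K := K) hN'
    rw [Finset.prod_map] at this
    simpa using this
  intro y hy
  rw [RingHom.mem_ker, h1] at hy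
  have hy' : ρ y ∈ nonfaceIdeal K 𝒦 := Ideal.Quotient.eq_zero_iff_mem.1 hy
  refine Ideal.Quotient.eq_zero_iff_mem.1 ?_
  have := DFunLike.congr_fun h2 y
  rw [Ideal.Quotient.mkₐ_eq_mk] at this
  rw [this]
  exact Ideal.Quotient.eq_zero_iff_mem.2 (h3 hy')

theorem faceEval_empty_projHom {ι : Type*} (h𝒦 : IsLowerSet 𝒦) (h0 : ∅ ∈ 𝒦)
    (p : MvPolynomial (ι ⊕ σ) K) :
    faceEval h𝒦 h0 (projHom (Ideal.Quotient.mkₐ K (nonfaceIdeal K 𝒦)) p) =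
      C (constantCoeff p) := by
  classical
  have h : (faceEval h𝒦 h0).comp (projHom (Ideal.Quotient.mkₐ K (nonfaceIdeal K 𝒦))) =
      (aeval fun _ => 0 : MvPolynomial (ι ⊕ σ) K →ₐ[K] MvPolynomial σ K) := by
    ext1 (i | v)
    · simp [projHom]
    · simp [projHom, faceEval_X]
  have := DFunLike.congr_fun h p
  rw [AlgHom.comp_apply] at this
  rw [this, aeval_zero']
  rfl

/-- If the kernel of a presentation on `n` variables is generated, locally at the origin, by `r`
elements, there are at most `r + #σ - n` minimal nonfaces. Indeed the kernel of the presentation on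
`n + #σ` variables given by `projHom` needs at least the number of generators on the left hand side,
and locally at the origin it is generated by the number of elements on the right hand side. -/
theorem card_minNonfaces_add_le [Finite σ] (h𝒦 : IsLowerSet 𝒦) (h0 : ∅ ∈ 𝒦) {n r : ℕ}
    {φ : MvPolynomial (Fin n) K →ₐ[K] MvPolynomial σ K ⧸ nonfaceIdeal K 𝒦}
    (hφ : Function.Surjective φ) (js : Fin r → MvPolynomial (Fin n) K)
    (hjs : ∀ k, js k ∈ RingHom.ker φ)
    (hgen : ∀ j ∈ RingHom.ker φ, ∃ s ∉ facePrime φ.toRingHom h𝒦 h0,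
      s * j ∈ Ideal.span (Set.range js)) :
    n + Nat.card {N // IsMinNonface 𝒦 N} ≤ Nat.card σ + r := by
  classical
  have := Fintype.ofFinite σ
  have := Fintype.ofFinite {N // IsMinNonface 𝒦 N}
  let χ := Ideal.Quotient.mkₐ K (nonfaceIdeal K 𝒦)
  have hχ : Function.Surjective χ := Ideal.Quotient.mk_surjective
  choose b hb using fun i => hχ (φ (X i))
  choose a ha using fun v => hφ (χ (X v))
  set L := nonfaceIdeal K (extendFamily (Fin n) 𝒦)
  have hkerL : RingHom.ker (projHom (ι := Fin n) χ) ≤ L := ker_projHom_le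
  -- The exponents of the minimal generators of the kernel of the combined presentation.
  let gen : Fin n ⊕ {N // IsMinNonface 𝒦 N} → Finset (Fin n ⊕ σ) :=
    Sum.elim (fun i => {Sum.inl i}) fun N => N.1.map Function.Embedding.inr
  have hgen_inj : Function.Injective gen := by
    rintro (i | N) (j | M) h
    · simpa [gen] using h
    · have : (Sum.inl i : Fin n ⊕ σ) ∈ gen (Sum.inr M) := h ▸ by simp [gen]
      simp [gen] at this
    · have : (Sum.inl j : Fin n ⊕ σ) ∈ gen (Sum.inr N) := h ▸ by simp [gen]
      simp [gen] at this
    · simpa [gen, Subtype.ext_iff] using h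
  have hgen_min : ∀ x, Minimal (· ∉ extendFamily (Fin n) 𝒦) (gen x) := by
    rintro (i | N)
    · exact minimal_singleton_inl h0 i
    · exact minimal_map_inr N.2
  have hgen_ker : ∀ x, ∏ v ∈ gen x, (X v : MvPolynomial (Fin n ⊕ σ) K) ∈
      RingHom.ker (projHom (ι := Fin n) χ) := by
    rintro (i | N)
    · simp [gen, projHom]
    · have hN : χ (∏ v ∈ N.1, X v) = 0 :=
        Ideal.Quotient.eq_zero_iff_mem.2 (prod_X_mem_nonfaceIdeal N.2.1.prop)
      rw [map_prod] at hN
      simpa [gen, projHom, RingHom.mem_ker] using hN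
  let Λ : MvPolynomial (Fin n ⊕ σ) K →ₗ[K] (Fin n ⊕ {N // IsMinNonface 𝒦 N} → K) :=
    LinearMap.pi fun x => lcoeff K (sqfreeExponent (gen x))
  have hΛ : ∀ c, ∀ l ∈ L, Λ (c * l) = constantCoeff c • Λ l := by
    intro c l hl
    ext x
    exact coeff_mul_of_minimal_nonface (isLowerSet_extendFamily h𝒦) (hgen_min x) c hl
  let w : σ ⊕ Fin r → (Fin n ⊕ {N // IsMinNonface 𝒦 N} → K) :=
    Sum.elim (fun v => Λ (X (Sum.inr v) - shiftHom b (a v))) fun k => Λ (shiftHom b (js k))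
  have hker := ker_projHom (χ := χ) (φ := φ) hb ha
  have hshift : ∀ j ∈ RingHom.ker φ, shiftHom b j ∈ L := fun j hj => hkerL <| by
    rw [RingHom.mem_ker, projHom_shiftHom hb]
    exact hj
  have hspan : ∀ y ∈ RingHom.ker (projHom (ι := Fin n) χ),
      Λ y ∈ Submodule.span K (Set.range w) := by
    intro y hy
    rw [hker] at hy
    refine map_mem_of_mem_span (L := L) Λ hΛ ?_ ?_ hy
    · exact (Ideal.span_le.1 hker.ge).trans hkerL
    · rintro _ (⟨j, hj, rfl⟩ | ⟨v, rfl⟩)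
      · obtain ⟨s, hs, hsj⟩ := hgen j hj
        have h1 : Λ (shiftHom b (s * j)) ∈ Submodule.span K (Set.range w) := by
          refine map_mem_of_mem_span (L := L) (T := shiftHom b '' Set.range js) Λ hΛ ?_ ?_ ?_
          · rintro _ ⟨_, ⟨k, rfl⟩, rfl⟩
            exact hshift _ (hjs k)
          · rintro _ ⟨_, ⟨k, rfl⟩, rfl⟩
            exact Submodule.subset_span ⟨Sum.inr k, rfl⟩
          · have := Ideal.mem_map_of_mem (shiftHom b) hsj
            rwa [Ideal.map_span] at this
        rw [map_mul, hΛ _ _ (hshift j hj)] at h1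
        refine (Submodule.smul_mem_iff _ fun hc => hs ?_).1 h1
        rw [mem_facePrime]
        change faceEval h𝒦 h0 (φ s) = 0
        rw [← projHom_shiftHom (χ := χ) hb s, faceEval_empty_projHom, hc, C_0]
      · exact Submodule.subset_span ⟨Sum.inl v, rfl⟩
  have htop : Submodule.span K (Set.range w) = ⊤ := by
    rw [eq_top_iff]
    rintro f -
    rw [pi_eq_sum_univ' f]
    refine Submodule.sum_mem _ fun x _ => Submodule.smul_mem _ _ ?_
    convert hspan _ (hgen_ker x) using 1
    ext y
    simp only [Λ, LinearMap.pi_apply, lcoeff_apply, coeff_sqfreeExponent_prod_X,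
      hgen_inj.eq_iff]
    rw [Pi.single_apply]
    exact if_congr eq_comm rfl rfl
  have hrank := finrank_range_le_card (R := K) w
  rw [Set.finrank, htop, finrank_top, Module.finrank_fintype_fun_eq_card] at hrank
  simpa [Nat.card_eq_fintype_card] using hrank

/-- In a complete intersection ring, the number of minimal nonfaces is at most the codimension of
the linear subspace of any face. -/
theorem card_minNonfaces_add_card_le [Finite σ] (h𝒦 : IsLowerSet 𝒦) (h0 : ∅ ∈ 𝒦)
    (hCI : IsCompleteIntersectionRing K (MvPolynomial σ K ⧸ nonfaceIdeal K 𝒦))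
    {F : Finset σ} (hF : F ∈ 𝒦) :
    Nat.card {N // IsMinNonface 𝒦 N} + F.card ≤ Nat.card σ := by
  obtain ⟨n, J, ⟨e⟩, hJ⟩ := hCI
  let φ : MvPolynomial (Fin n) K →ₐ[K] MvPolynomial σ K ⧸ nonfaceIdeal K 𝒦 :=
    e.symm.toAlgHom.comp (Ideal.Quotient.mkₐ K J)
  have hφ : Function.Surjective φ := e.symm.surjective.comp Ideal.Quotient.mk_surjective
  have hker : RingHom.ker φ = J := by
    ext p
    rw [RingHom.mem_ker]
    change e.symm (Ideal.Quotient.mk J p) = 0 ↔ _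
    rw [map_eq_zero_iff _ e.symm.injective, Ideal.Quotient.eq_zero_iff_mem]
  have hJle : ∀ {G : Finset σ} (hG : G ∈ 𝒦), J ≤ facePrime φ.toRingHom h𝒦 hG := by
    intro G hG j hj
    rw [← hker] at hj
    rw [mem_facePrime]
    change faceEval h𝒦 hG (φ j) = 0
    rw [RingHom.mem_ker.1 hj, map_zero]
  let P := facePrime φ.toRingHom h𝒦 h0
  let q := facePrime φ.toRingHom h𝒦 hF
  obtain ⟨rs, hreg, hrs⟩ := hJ P (hJle h0)
  obtain ⟨js, hjs, hgen⟩ := exists_numerators P J hrs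
  have h1 := card_minNonfaces_add_le h𝒦 h0 hφ js (fun k => hker ▸ hjs k) (by rwa [hker])
  -- The regular sequence lies in the prime of `F`, so its length is at most the height.
  have hqP : q ≤ P := facePrime_le _ h𝒦 h0 hF (Finset.empty_subset F)
  have hdisj : Disjoint (P.primeCompl : Set (MvPolynomial (Fin n) K)) q :=
    Set.disjoint_left.2 fun x hx hxq => hx (hqP hxq)
  have hprime := IsLocalization.isPrime_of_isPrime_disjoint P.primeCompl (Localization.AtPrime P) q
    inferInstance hdisj
  have h2 := length_le_height_of_isWeaklyRegular hreg.toIsWeaklyRegular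
    (q.map (algebraMap _ (Localization.AtPrime P))) fun r hr =>
      Ideal.map_mono (hJle hF) (hrs ▸ Ideal.subset_span hr)
  rw [IsLocalization.height_map_of_disjoint P.primeCompl q hdisj] at h2
  have h3 := height_facePrime_add_le (π := φ.toRingHom) hφ h𝒦 h0 hF (Finset.empty_subset F)
    (n := F.card) (by simp)
  have h4 := Ideal.height_le_ringKrullDim_of_isPrime (I := P)
  rw [MvPolynomial.ringKrullDim_of_isNoetherianRing, ringKrullDim_eq_zero_of_field, zero_add,
    Nat.card_eq_fintype_card, Fintype.card_fin] at h4
  have h5 : P.height ≤ n := WithBot.coe_le_coe.1 h4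
  have h6 : ((rs.length + F.card : ℕ) : ℕ∞) ≤ n := by
    rw [Nat.cast_add]
    exact (add_le_add_left h2 _).trans (h3.trans h5)
  have h7 : rs.length + F.card ≤ n := by exact_mod_cast h6
  omega

/-- The complement of a set meeting all minimal nonfaces is a face. If no such set has fewer
elements than there are minimal nonfaces, the minimal nonfaces are disjoint. -/
theorem disjointMinNonfaces_of_card_le [Finite σ] (h0 : ∅ ∈ 𝒦)
    (hv : ∀ v, {v} ∈ 𝒦)
    (hle : ∀ F ∈ 𝒦, Nat.card {N // IsMinNonface 𝒦 N} + F.card ≤ Nat.card σ) :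
    DisjointMinNonfaces 𝒦 := by
  classical
  have := Fintype.ofFinite σ
  intro A hA B hB hne
  by_contra hdis
  obtain ⟨v, hvA, hvB⟩ := Finset.not_disjoint_iff.1 hdis
  let S : Finset (Finset σ) := {N | IsMinNonface 𝒦 N}
  have hS : ∀ N, N ∈ S ↔ IsMinNonface 𝒦 N := by simp [S]
  have hcard : Nat.card {N // IsMinNonface 𝒦 N} = S.card := by
    rw [Nat.card_eq_fintype_card, Fintype.card_subtype]
  have hne' : ∀ N, IsMinNonface 𝒦 N → ∃ x, x ∈ N := fun N hN => by
    rw [← Finset.Nonempty, Finset.nonempty_iff_ne_empty]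
    rintro rfl
    exact hN.1.prop h0
  let f : Finset σ → σ := fun N => if h : IsMinNonface 𝒦 N then (hne' N h).choose else v
  have hf : ∀ N, IsMinNonface 𝒦 N → f N ∈ N := fun N hN => by
    simp only [f, dif_pos hN]
    exact (hne' N hN).choose_spec
  -- A set meeting all minimal nonfaces, with one element serving both `A` and `B`.
  let T := insert v (((S.erase A).erase B).image f)
  have hT : Tᶜ ∈ 𝒦 := by
    by_contra hnot
    obtain ⟨N, hNT, hN⟩ := exists_isMinNonface_subset hnot fun v _ => hv v
    have hmeet : ∃ x ∈ T, x ∈ N := by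
      by_cases hNA : N = A
      · exact ⟨v, by simp [T], hNA ▸ hvA⟩
      by_cases hNB : N = B
      · exact ⟨v, by simp [T], hNB ▸ hvB⟩
      · refine ⟨f N, Finset.mem_insert_of_mem (Finset.mem_image_of_mem f ?_), hf N hN⟩
        simp [hNA, hNB, hS, hN]
    obtain ⟨x, hxT, hxN⟩ := hmeet
    exact Finset.mem_compl.1 (hNT hxN) hxT
  have h1 := hle _ hT
  rw [hcard, Nat.card_eq_fintype_card, Finset.card_compl] at h1
  have hTc : T.card ≤ ((S.erase A).erase B).card + 1 :=
    (Finset.card_insert_le _ _).trans (Nat.add_le_add_right Finset.card_image_le 1)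
  have hBS : B ∈ S.erase A := Finset.mem_erase.2 ⟨fun h => hne h.symm, (hS B).2 hB⟩
  have hAS : A ∈ S := (hS A).2 hA
  have hc1 := Finset.card_erase_add_one hBS
  have hc2 := Finset.card_erase_add_one hAS
  have hTle := Finset.card_le_univ T
  omega

end Count

/-- An ideal generated by a regular sequence defines a complete intersection ring. -/
theorem Ideal.IsCompleteIntersection.isCompleteIntersectionRing [Finite σ]
    {I : Ideal (MvPolynomial σ K)} (hI : I.IsCompleteIntersection) :
    IsCompleteIntersectionRing K (MvPolynomial σ K ⧸ I) := by
  obtain ⟨rs, hreg, rfl⟩ := hI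
  obtain ⟨n, ⟨e⟩⟩ := Finite.exists_equiv_fin σ
  let E := renameEquiv K e
  refine ⟨n, (Ideal.ofList rs).map (E : MvPolynomial σ K →+* MvPolynomial (Fin n) K),
    ⟨Ideal.quotientEquivAlg _ _ E rfl⟩, fun P hP hJP => ?_⟩
  have hreg' : RingTheory.Sequence.IsWeaklyRegular (MvPolynomial (Fin n) K) (rs.map E) := by
    let := (E : MvPolynomial σ K →+* MvPolynomial (Fin n) K).toAlgebra
    have : Module.Flat (MvPolynomial σ K) (MvPolynomial (Fin n) K) :=
      RingHom.Flat.of_bijective (f := (E : MvPolynomial σ K →+* MvPolynomial (Fin n) K)) E.bijective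
    exact hreg.toIsWeaklyRegular.of_flat
  rw [Ideal.map_ofList] at hJP ⊢
  rw [Ideal.map_ofList]
  exact ⟨_, hreg'.isRegular_of_isLocalization_of_mem _ P fun r hr =>
    hJP (Ideal.subset_span hr), rfl⟩

end Presentations

/-! ### Serre's condition and connectedness of links -/

section Serre

open MvPolynomial

open scoped Pointwise in
/-- A local ring of depth at least two has a connected punctured spectrum, in the form needed for
ideals with zero product: if `a * b = 0` and `a + b` contains the maximal ideal, then one of `a`,
`b` is zero. -/
theorem eq_bot_or_eq_bot_of_two_le_depth {T : Type*} [CommRing T] [IsLocalRing T]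
    (hdepth : 2 ≤ localRingDepth T) {a b : Ideal T} (hab : a * b = ⊥)
    (hmax : IsLocalRing.maximalIdeal T ≤ a ⊔ b) : a = ⊥ ∨ b = ⊥ := by
  have hlt : (1 : ℕ∞) < localRingDepth T := lt_of_lt_of_le (by norm_num) hdepth
  obtain ⟨rs, hrs⟩ := lt_iSup_iff.1 hlt
  obtain ⟨⟨hmem, hreg⟩, hlen⟩ := lt_iSup_iff.1 hrs
  match rs, hmem, hreg, hlen with
  | [], _, _, hlen => simp at hlen
  | [_], _, _, hlen => simp at hlen
  | x :: y :: rs, hmem, hreg, _ =>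
  have hx := ((RingTheory.Sequence.isRegular_cons_iff _ _ _).1 hreg).1
  have hy := ((RingTheory.Sequence.isRegular_cons_iff _ _ _).1
    ((RingTheory.Sequence.isRegular_cons_iff _ _ _).1 hreg).2).1
  have hx0 : ∀ z, x * z = 0 → z = 0 := fun z hz => hx.right_eq_zero_of_smul hz
  have hzero : ∀ s ∈ a, ∀ t ∈ b, s * t = 0 := fun s hs t ht => by
    simpa [hab] using Ideal.mul_mem_mul hs ht
  obtain ⟨a₁, ha₁, b₁, hb₁, rfl⟩ := Submodule.mem_sup.1 (hmax (hmem x (by simp)))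
  obtain ⟨a₂, ha₂, b₂, hb₂, rfl⟩ := Submodule.mem_sup.1 (hmax (hmem y (by simp)))
  have hy' : a₁ ∈ ((a₁ + b₁) • ⊤ : Submodule T T) := by
    refine (isSMulRegular_quotient_iff_mem_of_smul_mem _ _).1 hy a₁ ?_
    refine (Submodule.mem_smul_pointwise_iff_exists _ _ _).2 ⟨a₂, trivial, ?_⟩
    simp only [smul_eq_mul]
    linear_combination hzero a₂ ha₂ b₁ hb₁ - hzero a₁ ha₁ b₂ hb₂
  obtain ⟨c, -, hc⟩ := (Submodule.mem_smul_pointwise_iff_exists _ _ _).1 hy'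
  rw [smul_eq_mul] at hc
  rcases IsLocalRing.isUnit_or_isUnit_one_sub_self c with hu | hu
  · right
    have hb₁a : b₁ ∈ a := by
      refine (Ideal.unit_mul_mem_iff_mem a hu).1 ?_
      rw [show c * b₁ = (1 - c) * a₁ by linear_combination hc]
      exact a.mul_mem_left _ ha₁
    have hb0 : b₁ = 0 := hx0 _ (by
      rw [add_mul, hzero a₁ ha₁ b₁ hb₁, hzero b₁ hb₁a b₁ hb₁, add_zero])
    refine (Submodule.eq_bot_iff _).2 fun z hz => hx0 z ?_
    rw [hb0, add_zero, hzero a₁ ha₁ z hz]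
  · left
    have ha₁b : a₁ ∈ b := by
      refine (Ideal.unit_mul_mem_iff_mem b hu).1 ?_
      rw [show (1 - c) * a₁ = c * b₁ by linear_combination -hc]
      exact b.mul_mem_left _ hb₁
    have ha0 : a₁ = 0 := hx0 _ (by
      rw [add_mul, mul_comm b₁, hzero a₁ ha₁ b₁ hb₁, hzero a₁ ha₁ a₁ ha₁b, add_zero])
    refine (Submodule.eq_bot_iff _).2 fun z hz => hx0 z ?_
    rw [ha0, zero_add, mul_comm, hzero z hz b₁ hb₁]

variable {σ : Type*} {K : Type*} [Field K] {𝒦 : Set (Finset σ)}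

theorem facePrime_id_le_span (h𝒦 : IsLowerSet 𝒦) {F : Finset σ} (hF : F ∈ 𝒦) :
    facePrime (RingHom.id (MvPolynomial σ K ⧸ nonfaceIdeal K 𝒦)) h𝒦 hF ≤
      Ideal.span ((fun v => Ideal.Quotient.mk (nonfaceIdeal K 𝒦) (X v)) '' {v | v ∉ F}) := by
  classical
  set D := Ideal.span ((fun v => Ideal.Quotient.mk (nonfaceIdeal K 𝒦) (X v)) '' {v | v ∉ F})
  let χ := Ideal.Quotient.mkₐ K (nonfaceIdeal K 𝒦)
  have h : (Ideal.Quotient.mkₐ K D).comp χ =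
      (((Ideal.Quotient.mkₐ K D).comp χ).comp (faceEval h𝒦 hF)).comp χ := by
    ext v
    have h1 : faceEval h𝒦 hF (χ (X v)) = if v ∈ F then X v else 0 := faceEval_X h𝒦 hF v
    simp only [AlgHom.comp_apply, h1]
    by_cases hv : v ∈ F
    · rw [if_pos hv]
    · rw [if_neg hv, map_zero, map_zero]
      exact Ideal.Quotient.eq_zero_iff_mem.2 (Ideal.subset_span ⟨v, hv, rfl⟩)
  intro r hr
  obtain ⟨p, rfl⟩ := Ideal.Quotient.mk_surjective r
  have h2 : faceEval h𝒦 hF (χ p) = 0 := hr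
  have h3 := DFunLike.congr_fun h p
  simp only [AlgHom.comp_apply, h2, map_zero] at h3
  exact Ideal.Quotient.eq_zero_iff_mem.1 h3

/-- Serre's condition `(S₂)` makes all links of dimension at least one connected. -/
theorem connectedFamily_linkFamily_of_satisfiesSerreS2 [DecidableEq σ] (h𝒦 : IsLowerSet 𝒦)
    (hS2 : SatisfiesSerreS2 (MvPolynomial σ K ⧸ nonfaceIdeal K 𝒦)) {F : Finset σ} (hF : F ∈ 𝒦)
    (hG : ∃ G ∈ 𝒦, F ⊆ G ∧ F.card + 2 ≤ G.card) : ConnectedFamily (linkFamily 𝒦 F) := by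
  obtain ⟨G, hG, hFG, hcard⟩ := hG
  intro S hS hclosed w hw
  by_contra hwS
  obtain ⟨v, hvS, hv⟩ := hS
  set R := MvPolynomial σ K ⧸ nonfaceIdeal K 𝒦
  let ξ : σ → R := fun v => Ideal.Quotient.mk (nonfaceIdeal K 𝒦) (X v)
  let P := facePrime (RingHom.id R) h𝒦 hF
  let T := Localization.AtPrime P
  have hheight : (2 : ℕ∞) ≤ P.height := by
    have := height_facePrime_add_le (π := RingHom.id R) Function.surjective_id h𝒦 hF hG hFG
      (n := G.card - F.card) (by omega)
    refine le_trans ?_ (le_add_self.trans this)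
    exact_mod_cast (show 2 ≤ G.card - F.card by omega)
  have hdepth : 2 ≤ localRingDepth T := by
    have h := hS2.2 P
    rw [IsLocalization.AtPrime.ringKrullDim_eq_height P, min_eq_right] at h
    · exact WithBot.coe_le_coe.1 h
    · exact WithBot.coe_le_coe.2 hheight
  -- A variable that extends `F` to a larger face does not vanish in the localization.
  have hne : ∀ u, {u} ∈ linkFamily 𝒦 F → algebraMap R T (ξ u) ≠ 0 := by
    intro u hu h0
    obtain ⟨⟨s, hs⟩, hs0⟩ := (IsLocalization.map_eq_zero_iff P.primeCompl T _).1 h0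
    refine hs (facePrime_le _ h𝒦 hF hu.2 Finset.subset_union_right ?_)
    rw [mem_facePrime]
    have h1 := congrArg (faceEval h𝒦 hu.2) hs0
    rw [map_mul, map_zero] at h1
    have h2 : faceEval h𝒦 hu.2 (ξ u) = X u := by
      rw [faceEval_X, if_pos (by simp)]
    rw [h2] at h1
    exact (mul_eq_zero.1 h1).resolve_right (X_ne_zero u)
  have hzero : ∀ u ∈ S, ∀ t ∉ S, u ∉ F → t ∉ F →
      algebraMap R T (ξ u) * algebraMap R T (ξ t) = 0 := by
    intro u hu t ht huF htF
    have hut : u ≠ t := by rintro rfl; exact ht hu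
    have hnot : {u, t} ∪ F ∉ 𝒦 := fun h => ht (hclosed u hu t ⟨by simp [huF, htF], h⟩)
    rw [← map_mul, IsLocalization.map_eq_zero_iff P.primeCompl T]
    refine ⟨⟨∏ v ∈ F, ξ v, fun hmem => ?_⟩, ?_⟩
    · have h1 : faceEval h𝒦 hF (∏ v ∈ F, ξ v) = 0 := hmem
      rw [map_prod, Finset.prod_eq_zero_iff] at h1
      obtain ⟨z, hz, hz0⟩ := h1
      rw [faceEval_X, if_pos hz] at hz0
      exact X_ne_zero z hz0
    · have h1 := Ideal.Quotient.eq_zero_iff_mem.2 (prod_X_mem_nonfaceIdeal (K := K) hnot)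
      rw [Finset.prod_union (by simp [huF, htF]), Finset.prod_pair hut, map_mul, map_mul,
        map_prod, mul_comm] at h1
      exact h1
  -- A vertex in `S` and a vertex outside `S` are not adjacent in the link of `F`, so the variables
  -- outside `F` split into two groups that generate ideals with product zero.
  let ideal (U : Set σ) : Ideal T :=
    Ideal.span ((fun u => algebraMap R T (ξ u)) '' {u | u ∉ F ∧ u ∈ U})
  have hprod : ideal S * ideal Sᶜ = ⊥ := by
    rw [Ideal.span_mul_span', Ideal.span_eq_bot]
    rintro _ ⟨_, ⟨u, ⟨huF, hu⟩, rfl⟩, _, ⟨t, ⟨htF, ht⟩, rfl⟩, rfl⟩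
    exact hzero u hu t ht huF htF
  have hmax : IsLocalRing.maximalIdeal T ≤ ideal S ⊔ ideal Sᶜ := by
    rw [← Localization.AtPrime.map_eq_maximalIdeal]
    refine (Ideal.map_mono (facePrime_id_le_span h𝒦 hF)).trans ?_
    rw [Ideal.map_span, Ideal.span_le]
    rintro _ ⟨_, ⟨u, hu, rfl⟩, rfl⟩
    by_cases huS : u ∈ S
    · exact Ideal.mem_sup_left (Ideal.subset_span ⟨u, ⟨hu, huS⟩, rfl⟩)
    · exact Ideal.mem_sup_right (Ideal.subset_span ⟨u, ⟨hu, huS⟩, rfl⟩)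
  rcases eq_bot_or_eq_bot_of_two_le_depth hdepth hprod hmax with h | h
  · exact hne v hv (Ideal.span_eq_bot.1 h _
      ⟨v, ⟨Finset.disjoint_singleton_left.1 hv.1, hvS⟩, rfl⟩)
  · exact hne w hw (Ideal.span_eq_bot.1 h _
      ⟨w, ⟨Finset.disjoint_singleton_left.1 hw.1, hwS⟩, rfl⟩)

end Serre

/-! ### Complete intersection complexes and their links -/

namespace PreAbstractSimplicialComplex

variable {V : Type*} (Γ : PreAbstractSimplicialComplex V)

/-- The faces of `Γ`, the empty one included. -/
def faceFamily : Set (Finset V) := {F | Γ.IsFace F}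

/-- The faces of `Γ`, as sets of elements of the subtype of vertices; these are the indices of the
variables of the Stanley-Reisner ring, whose ideal is `nonfaceIdeal K Γ.vertexFaceFamily` by
definition. -/
def vertexFaceFamily : Set (Finset Γ.vertices) :=
  {F | Γ.IsFace (F.map (Function.Embedding.subtype _))}

theorem empty_mem_faceFamily : ∅ ∈ Γ.faceFamily := Or.inl rfl

theorem isLowerSet_faceFamily : IsLowerSet Γ.faceFamily := by
  intro A B hBA hA
  rcases B.eq_empty_or_nonempty with rfl | hB
  · exact Γ.empty_mem_faceFamily
  · rcases hA with rfl | hA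
    · exact Or.inl (Finset.subset_empty.1 hBA)
    · exact Or.inr ((Γ.isRelLowerSet_faces hA).2 hBA hB)

theorem singleton_mem_faceFamily {v : V} : {v} ∈ Γ.faceFamily ↔ v ∈ Γ.vertices :=
  or_iff_right (Finset.singleton_ne_empty v)

theorem mem_vertexFaceFamily {F : Finset Γ.vertices} :
    F ∈ Γ.vertexFaceFamily ↔ F.map (Function.Embedding.subtype _) ∈ Γ.faceFamily := Iff.rfl

theorem empty_mem_vertexFaceFamily : ∅ ∈ Γ.vertexFaceFamily := Or.inl (Finset.map_empty _)

theorem isLowerSet_vertexFaceFamily : IsLowerSet Γ.vertexFaceFamily := fun _ _ hBA hA =>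
  Γ.isLowerSet_faceFamily (Finset.map_subset_map.2 hBA) hA

theorem singleton_mem_vertexFaceFamily (v : Γ.vertices) : {v} ∈ Γ.vertexFaceFamily :=
  Or.inr (by rw [Finset.map_singleton]; exact v.2)

theorem exists_map_eq {A : Finset V} (hA : ∀ v ∈ A, {v} ∈ Γ.faceFamily) :
    ∃ N : Finset Γ.vertices, N.map (Function.Embedding.subtype _) = A := by
  classical
  exact ⟨A.subtype (· ∈ Γ.vertices), Finset.subtype_map_of_mem fun v hv =>
    Γ.singleton_mem_faceFamily.1 (hA v hv)⟩

theorem isMinNonface_vertexFaceFamily_iff {N : Finset Γ.vertices} :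
    IsMinNonface Γ.vertexFaceFamily N ↔
      IsMinNonface Γ.faceFamily (N.map (Function.Embedding.subtype _)) := by
  constructor
  · intro h
    refine isMinNonface_of_ssubset h.1.prop (fun v hv => ?_) fun M hM => ?_
    · obtain ⟨u, -, rfl⟩ := Finset.mem_map.1 hv
      exact Γ.singleton_mem_faceFamily.2 u.2
    · obtain ⟨M', -, rfl⟩ := Finset.subset_map_iff.1 hM.1
      exact h.mem_of_ssubset (Finset.map_ssubset_map.1 hM)
  · intro h
    exact isMinNonface_of_ssubset h.1.prop (fun v _ => Γ.singleton_mem_vertexFaceFamily v)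
      fun M hM => h.mem_of_ssubset (Finset.map_ssubset_map.2 hM)

theorem disjointMinNonfaces_vertexFaceFamily_iff :
    DisjointMinNonfaces Γ.vertexFaceFamily ↔ DisjointMinNonfaces Γ.faceFamily := by
  constructor
  · intro h A hA B hB hne
    obtain ⟨N, rfl⟩ := Γ.exists_map_eq hA.2
    obtain ⟨M, rfl⟩ := Γ.exists_map_eq hB.2
    exact (Finset.disjoint_map _).2 (h (Γ.isMinNonface_vertexFaceFamily_iff.2 hA)
      (Γ.isMinNonface_vertexFaceFamily_iff.2 hB) fun h => hne (h ▸ rfl))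
  · intro h N hN M hM hne
    exact (Finset.disjoint_map (Function.Embedding.subtype _)).1
      (h (Γ.isMinNonface_vertexFaceFamily_iff.1 hN) (Γ.isMinNonface_vertexFaceFamily_iff.1 hM)
        fun h => hne (Finset.map_injective _ h))

theorem isCompleteIntersection_of_disjointMinNonfaces [Finite V] (K : Type*) [Field K]
    (h : DisjointMinNonfaces Γ.faceFamily) : Γ.IsCompleteIntersection K :=
  (Γ.disjointMinNonfaces_vertexFaceFamily_iff.2 h).isCompleteIntersection_nonfaceIdeal
    Γ.isLowerSet_vertexFaceFamily Γ.empty_mem_vertexFaceFamily Γ.singleton_mem_vertexFaceFamily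

/-- The Stanley-Reisner ring is a complete intersection ring, over any field, if and only if the
minimal nonfaces are pairwise disjoint. -/
theorem isCompleteIntersectionRing_iff [Finite V] (K : Type*) [Field K] :
    IsCompleteIntersectionRing K (Γ.StanleyReisnerRing K) ↔ DisjointMinNonfaces Γ.faceFamily := by
  constructor
  · intro h
    rw [← disjointMinNonfaces_vertexFaceFamily_iff]
    exact disjointMinNonfaces_of_card_le Γ.empty_mem_vertexFaceFamily
      Γ.singleton_mem_vertexFaceFamily fun F hF => card_minNonfaces_add_card_le
        Γ.isLowerSet_vertexFaceFamily Γ.empty_mem_vertexFaceFamily h hF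
  · intro h
    exact (isCompleteIntersection_of_disjointMinNonfaces Γ K h).isCompleteIntersectionRing

/-- A complex is a complete intersection complex, over any field, if and only if its minimal
nonfaces are pairwise disjoint. -/
theorem isCompleteIntersection_iff [Finite V] (K : Type*) [Field K] :
    Γ.IsCompleteIntersection K ↔ DisjointMinNonfaces Γ.faceFamily :=
  ⟨fun h => (Γ.isCompleteIntersectionRing_iff K).1 h.isCompleteIntersectionRing,
    isCompleteIntersection_of_disjointMinNonfaces Γ K⟩

theorem faceFamily_link [DecidableEq V] {F : Finset V} (hF : F ∈ Γ.faceFamily) :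
    (Γ.link F).faceFamily = linkFamily Γ.faceFamily F := by
  ext G
  constructor
  · rintro (rfl | ⟨-, hGF, hd⟩)
    · exact ⟨Finset.disjoint_empty_left _, by simpa using hF⟩
    · exact ⟨(Finset.disjoint_iff_inter_eq_empty.2 hd).symm, hGF⟩
  · rintro ⟨hd, hGF⟩
    rcases Γ.isLowerSet_faceFamily (Finset.subset_union_left : G ⊆ G ∪ F) hGF with h | h
    · exact Or.inl h
    · exact Or.inr ⟨h, hGF, Finset.disjoint_iff_inter_eq_empty.1 hd.symm⟩

theorem card_le_dim_add_one [Finite V] {F : Finset V} (hF : F ∈ Γ.faceFamily) :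
    (F.card : ℤ) ≤ Γ.dim + 1 := by
  rw [dim, sub_add_cancel]
  exact Nat.cast_le.2 (le_csSup (Set.toFinite _).bddAbove ⟨F, hF, rfl⟩)

theorem exists_card_eq_dim_add_one [Finite V] : ∃ F ∈ Γ.faceFamily, (F.card : ℤ) = Γ.dim + 1 := by
  have hne : (Finset.card '' {F | Γ.IsFace F}).Nonempty := ⟨_, ∅, Γ.empty_mem_faceFamily, rfl⟩
  obtain ⟨F, hF, h⟩ := Nat.sSup_mem hne (Set.toFinite _).bddAbove
  exact ⟨F, hF, by rw [dim, sub_add_cancel, h]⟩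

theorem connectedFamily_linkFamily_of_satisfiesSerreS2 [DecidableEq V] {K : Type*} [Field K]
    (hS2 : SatisfiesSerreS2 (Γ.StanleyReisnerRing K)) {F : Finset V} (hF : F ∈ Γ.faceFamily)
    (hG : ∃ G ∈ Γ.faceFamily, F ⊆ G ∧ F.card + 2 ≤ G.card) :
    ConnectedFamily (linkFamily Γ.faceFamily F) := by
  obtain ⟨G, hG, hFG, hcard⟩ := hG
  have hvert : ∀ A ∈ Γ.faceFamily, ∀ v ∈ A, {v} ∈ Γ.faceFamily := fun A hA v hv =>
    Γ.isLowerSet_faceFamily (Finset.singleton_subset_iff.2 hv) hA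
  obtain ⟨F, rfl⟩ := Γ.exists_map_eq (hvert F hF)
  obtain ⟨G, rfl⟩ := Γ.exists_map_eq (hvert G hG)
  have hlink : ∀ A : Finset Γ.vertices, A ∈ linkFamily Γ.vertexFaceFamily F ↔
      A.map (Function.Embedding.subtype _) ∈
        linkFamily Γ.faceFamily (F.map (Function.Embedding.subtype _)) := by
    intro A
    simp only [linkFamily, Set.mem_ofPred_eq, Finset.disjoint_map, mem_vertexFaceFamily,
      Finset.map_union]
  have hmem : ∀ A ∈ linkFamily Γ.faceFamily (F.map (Function.Embedding.subtype _)), ∀ v ∈ A,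
      v ∈ Γ.vertices := fun A hA v hv => Γ.singleton_mem_faceFamily.1
    (hvert _ hA.2 v (Finset.mem_union_left _ hv))
  have hconn := _root_.connectedFamily_linkFamily_of_satisfiesSerreS2
    Γ.isLowerSet_vertexFaceFamily hS2 hF
    ⟨G, hG, Finset.map_subset_map.1 hFG, by simpa using hcard⟩
  rintro S ⟨v, hvS, hv⟩ hclosed w hw
  refine hconn (Subtype.val ⁻¹' S) ⟨⟨v, hmem _ hv v (by simp)⟩, hvS, ?_⟩ ?_
    ⟨w, hmem _ hw w (by simp)⟩ ?_
  · rw [hlink]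
    simpa using hv
  · intro u hu t hut
    refine hclosed u hu t ?_
    rw [hlink] at hut
    simpa using hut
  · rw [hlink]
    simpa using hw

end PreAbstractSimplicialComplex

theorem corollary1p6 {V : Type*} [Fintype V] [DecidableEq V] (K : Type*) [Field K]
    (Δ : AbstractSimplicialComplex V)
    (hdim : 2 ≤ Δ.toPreAbstractSimplicialComplex.dim)
    (hS2 : SatisfiesSerreS2 (Δ.toPreAbstractSimplicialComplex.StanleyReisnerRing K)) :
    List.TFAE [
      IsCompleteIntersectionRing K (Δ.toPreAbstractSimplicialComplex.StanleyReisnerRing K),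
      ∀ F : Finset V, Δ.toPreAbstractSimplicialComplex.IsFace F →
        (Δ.toPreAbstractSimplicialComplex.link F).dim = 1 →
        (Δ.toPreAbstractSimplicialComplex.link F).IsCompleteIntersection K,
      ∃ W : Set V,
        (Δ.toPreAbstractSimplicialComplex.restrict Wᶜ).dim ≤
          Δ.toPreAbstractSimplicialComplex.dim - 3 ∧
        ∀ x ∈ W, (Δ.toPreAbstractSimplicialComplex.link {x}).IsCompleteIntersection K] := by
  set Γ := Δ.toPreAbstractSimplicialComplex
  have hsingle : ∀ v, {v} ∈ Γ.faceFamily := fun v => Or.inr (Δ.singleton_mem v)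
  have hlower := Γ.isLowerSet_faceFamily
  have hconn : ∀ F ∈ Γ.faceFamily, (∃ G ∈ Γ.faceFamily, F ⊆ G ∧ F.card + 2 ≤ G.card) →
      ConnectedFamily (linkFamily Γ.faceFamily F) := fun F hF hG =>
    Γ.connectedFamily_linkFamily_of_satisfiesSerreS2 hS2 hF hG
  obtain ⟨D, hD, hDcard⟩ := Γ.exists_card_eq_dim_add_one
  have hDmax : Maximal (· ∈ Γ.faceFamily) D := by
    obtain ⟨G, hDG, hG⟩ := exists_maximal_ge_of_wellFoundedGT (· ∈ Γ.faceFamily) D hD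
    have := Γ.card_le_dim_add_one hG.prop
    rwa [Finset.eq_of_subset_of_card_le hDG (by omega)]
  simp only [Γ.isCompleteIntersectionRing_iff,
    PreAbstractSimplicialComplex.isCompleteIntersection_iff]
  tfae_have 1 → 3 := by
    intro h
    refine ⟨Set.univ, ?_, fun x _ => ?_⟩
    · obtain ⟨A, hA, hcard⟩ := (Γ.restrict Set.univᶜ).exists_card_eq_dim_add_one
      have hA0 : A = ∅ := by
        rcases hA with hA | ⟨-, hA⟩
        · exact hA
        · simpa using hA
      rw [hA0, Finset.card_empty, Nat.cast_zero] at hcard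
      omega
    · rw [Γ.faceFamily_link (hsingle x)]
      exact h.linkFamily hlower (hsingle x)
  tfae_have 3 → 2 := by
    rintro ⟨W, hW, hlink⟩ F hF hdimF
    -- By purity `#F = dim Δ - 1`, so `F` is too large to avoid `W`.
    have hFW : ∃ x ∈ F, x ∈ W := by
      by_contra! hFW
      have hFres : F ∈ (Γ.restrict Wᶜ).faceFamily := by
        rcases hF with hF | hF
        · exact Or.inl hF
        · exact Or.inr ⟨hF, fun x hx => hFW x hx⟩
      have h1 := (Γ.restrict Wᶜ).card_le_dim_add_one hFres
      obtain ⟨G, hFG, hG⟩ := exists_maximal_ge_of_wellFoundedGT (· ∈ Γ.faceFamily) F hF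
      have hFG : F ⊆ G := hFG
      have h2 := card_eq_of_maximal hlower hconn hG hDmax
      have h3 : G \ F ∈ (Γ.link F).faceFamily := by
        rw [Γ.faceFamily_link hF]
        exact ⟨Finset.sdiff_disjoint, by rw [Finset.sdiff_union_of_subset hFG]; exact hG.prop⟩
      have h4 := (Γ.link F).card_le_dim_add_one h3
      have h5 := Finset.card_sdiff_add_card_eq_card hFG
      omega
    obtain ⟨x, hxF, hxW⟩ := hFW
    have hx := hlink x hxW
    rw [Γ.faceFamily_link (hsingle x)] at hx
    have hdisj : Disjoint {x} (F.erase x) := by simp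
    have hFx : {x} ∪ F.erase x = F := by
      rw [Finset.singleton_union, Finset.insert_erase hxF]
    rw [Γ.faceFamily_link hF, ← hFx, ← linkFamily_linkFamily _ hdisj]
    refine hx.linkFamily (isLowerSet_linkFamily hlower _) ⟨hdisj.symm, ?_⟩
    rw [Finset.union_comm, hFx]
    exact hF
  tfae_have 2 → 1 := by
    intro h
    refine disjointMinNonfaces_of_one_dim_links hlower hD (by omega) hconn fun F hF hex hle => ?_
    have := h F hF
    rw [Γ.faceFamily_link hF] at this
    refine this ?_
    obtain ⟨G, hG, hG2⟩ := hex
    obtain ⟨A, hA, hAcard⟩ := (Γ.link F).exists_card_eq_dim_add_one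
    rw [← Γ.faceFamily_link hF] at hG hle
    have h1 := (Γ.link F).card_le_dim_add_one hG
    have h2 := hle A hA
    omega
  tfae_finish
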